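/- Let $\mathbb{S}^1=\mathbb{R}/2\pi\mathbb{Z}$, $\mathbb{T}^2=\mathbb{S}^1\times\mathbb{S}^1$ with points $x=(q,p)$, and let $f_1,f_2:\mathbb{S}^1\to\mathbb{R}$ be non-constant real-analytic functions. Put $C_{f_i}=\{z\in\mathbb{S}^1: f_i(z)=0\}$, $C_{f_i'}=\{z\in\mathbb{S}^1:f_i'(z)=0\}$, \[ \varphi^{(1)}_\tau(q,p)=(q+\tau f_1(p),\,p),\qquad \varphi^{(2)}_\tau(q,p)=(q,\,p+\tau f_2(q)), \] $F=\{(q,p): f_1(p)=0 \text{ and } f_2(q)=0\}$ and $\mathcal{O}=\mathbb{T}^2\setminus F$. For $T>0$ let $\tau_1,\tau_2,\dots$ be i.i.d. uniformly distributed on $[0,T]$; let $\Phi^0_{\underline\tau}=\mathrm{id}$ and $\Phi^m_{\underline\tau}=\varphi^{(2)}_{\tau_{2m}}\circ\varphi^{(1)}_{\tau_{2m-1}}\circ\Phi^{m-1}_{\underline\tau}$ for $m\ge 1$. This is a Markov chain on $\mathcal{O}$ with transition kernel $P_T(x,A)=\mathbb{P}(\Phi^1_{\underline\tau}(x)\in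 A)$. A probability measure $\mu$ on $\mathcal{O}$ is stationary if $\int P_T(x,A)\,\mu(dx)=\mu(A)$ for all Borel $A\subseteq\mathcal{O}$. For $V:\mathcal{O}\to[1,\infty)$ let $\|g\|_V=\sup_{x\in\mathcal{O}}|g(x)|/V(x)$. The kernel $P_T$ is called $V$-uniformly geometrically ergodic if it has a unique stationary measure $\mu$ and there are $C>0$ and $\gamma\in(0,1)$ such that every measurable $g:\mathcal{O}\to\mathbb{R}$ with $\|g\|_V<\infty$ is integrable with respect to $\mu$ and to all $P_T^m(x,\cdot)$, and \[ \Big|P_T^m g(x)-\int g\,d\mu\Big|\le C\,V(x)\,\|g\|_V\,\gamma^m\qquad\text{for all }x\in\mathcal{O},\ m\ge 0 . \] **Theorem.** Assume (H1): $C_{f_i}\cap C_{f_i'}=\emptyset$ for $i=1,2$, i.e. all zeros of $f_1$ and $f_2$ are simple. Then there are constants $\beta\in(0,\tfrac12)$ and $b>0$ such that \[ V(q,p)=\max\big(d(q,C_{f_2}),\,d(p,C_{f_1})\big)^{-\beta}+b \] (with the conventions $d(\cdot,\emptyset)=\infty$ and $\infty^{-\beta}=0$) is a continuous function $\mathcal{O}\to[1,\infty)$,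 and there is $T_0>0$ such that for every $T\ge T_0$ the normalized Lebesgue measure on $\mathcal{O}$ is the unique stationary measure of $P_T$, and $P_T$ is $V$-uniformly geometrically ergodic. -/

import Mathlib

namespace ShearFlow

open MeasureTheory ProbabilityTheory Set

noncomputable section

instance factTwoPiPos : Fact ((0 : ℝ) < 2 * Real.pi) := ⟨Real.two_pi_pos⟩

/-- The circle `ℝ / 2πℤ`, with its quotient metric and Lebesgue measure of total mass `2π`. -/
abbrev S1 : Type := AddCircle (2 * Real.pi)

/-- The two-torus, with points `x = (q, p)`. -/
abbrev T2 : Type := S1 × S1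

/-- Real-analyticity of a function on the circle: its `2π`-periodic lift to `ℝ` is analytic. -/
def IsAnalytic (f : S1 → ℝ) : Prop :=
  ∀ t : ℝ, AnalyticAt ℝ (fun s : ℝ => f (s : S1)) t

/-- The derivative of a function on the circle. -/
def circleDeriv (f : S1 → ℝ) (z : S1) : ℝ :=
  deriv (fun t : ℝ => f (z + (t : S1))) 0

/-- The zero set `C_f` of a function on the circle. -/
def zeroSet (f : S1 → ℝ) : Set S1 := {z | f z = 0}

/-- The horizontal shear `(q, p) ↦ (q + τ f₁(p), p)`. -/
def shear₁ (f₁ : S1 → ℝ) (τ : ℝ) (x : T2) : T2 := (x.1 + ((τ * f₁ x.2 : ℝ) : S1), x.2)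

/-- The vertical shear `(q, p) ↦ (q, p + τ f₂(q))`. -/
def shear₂ (f₂ : S1 → ℝ) (τ : ℝ) (x : T2) : T2 := (x.1, x.2 + ((τ * f₂ x.1 : ℝ) : S1))

/-- The composition `Φ^m` of random shears. The times are indexed from `0`: step `m + 1` uses
`τ (2m)` for the horizontal and then `τ (2m + 1)` for the vertical shear. -/
def flow (f₁ f₂ : S1 → ℝ) (τ : ℕ → ℝ) : ℕ → T2 → T2
  | 0, x => x
  | m + 1, x => shear₂ f₂ (τ (2 * m + 1)) (shear₁ f₁ (τ (2 * m)) (flow f₁ f₂ τ m x))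

/-- The set `F` of common zeros of the two shear fields. -/
def fixedSet (f₁ f₂ : S1 → ℝ) : Set T2 := {x | f₁ x.2 = 0 ∧ f₂ x.1 = 0}

/-- The state space `𝒪 = 𝕋² \ F`. -/
abbrev Phase (f₁ f₂ : S1 → ℝ) : Type := ((fixedSet f₁ f₂)ᶜ : Set T2)

theorem shear₁_mem {f₁ f₂ : S1 → ℝ} (τ : ℝ) {x : T2} (hx : x ∈ (fixedSet f₁ f₂)ᶜ) :
    shear₁ f₁ τ x ∈ (fixedSet f₁ f₂)ᶜ := by
  rintro ⟨h1, h2⟩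
  have h1' : f₁ x.2 = 0 := h1
  exact hx ⟨h1', by simpa [shear₁, h1'] using h2⟩

theorem shear₂_mem {f₁ f₂ : S1 → ℝ} (τ : ℝ) {x : T2} (hx : x ∈ (fixedSet f₁ f₂)ᶜ) :
    shear₂ f₂ τ x ∈ (fixedSet f₁ f₂)ᶜ := by
  rintro ⟨h1, h2⟩
  have h2' : f₂ x.1 = 0 := h2
  exact hx ⟨by simpa [shear₂, h2'] using h1, h2'⟩

theorem flow_mem {f₁ f₂ : S1 → ℝ} (τ : ℕ → ℝ) (m : ℕ) {x : T2}
    (hx : x ∈ (fixedSet f₁ f₂)ᶜ) : flow f₁ f₂ τ m x ∈ (fixedSet f₁ f₂)ᶜ := by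
  induction m with
  | zero => exact hx
  | succ m ih => exact shear₂_mem _ (shear₁_mem _ ih)

/-- The one-point chain `Φ^m` as a random map of `𝒪`. -/
def chain (f₁ f₂ : S1 → ℝ) (τ : ℕ → ℝ) (m : ℕ) (x : Phase f₁ f₂) : Phase f₁ f₂ :=
  ⟨flow f₁ f₂ τ m x, flow_mem τ m x.2⟩

/-- The law of the sequence of times: i.i.d., uniform on `[0, T]`. -/
def timeLaw (T : ℝ) : Measure (ℕ → ℝ) :=
  Measure.infinitePi fun _ : ℕ => ProbabilityTheory.cond (volume : Measure ℝ) (Icc 0 T)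

instance isFiniteMeasure_timeLaw (T : ℝ) : IsFiniteMeasure (timeLaw T) := by
  by_cases h : IsProbabilityMeasure (ProbabilityTheory.cond (volume : Measure ℝ) (Icc 0 T))
  · unfold timeLaw
    infer_instance
  · have : timeLaw T = 0 := by
      unfold timeLaw Measure.infinitePi
      rw [dif_neg]
      exact fun H => h (H 0)
    rw [this]
    infer_instance

theorem measurable_chain_one (f₁ f₂ : C(S1, ℝ)) :
    Measurable fun y : Phase f₁ f₂ × (ℕ → ℝ) => chain f₁ f₂ y.2 1 y.1 := by
  refine Measurable.subtype_mk ?_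
  have h : Continuous fun y : T2 × (ℕ → ℝ) => flow f₁ f₂ y.2 1 y.1 := by
    have hc : Continuous fun t : ℝ => (t : S1) := AddCircle.continuous_mk' _
    simp only [flow, shear₁, shear₂]
    fun_prop
  exact h.measurable.comp ((measurable_subtype_coe.comp measurable_fst).prodMk measurable_snd)

/-- The transition kernel `P(x, A) = ℙ(Φ_τ(x) ∈ A)` of the one-point chain on `𝒪`. -/
def transition (f₁ f₂ : C(S1, ℝ)) (T : ℝ) : Kernel (Phase f₁ f₂) (Phase f₁ f₂) where
  toFun x := (timeLaw T).map fun τ => chain f₁ f₂ τ 1 x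
  measurable' := by
    refine Measure.measurable_of_measurable_coe _ fun A hA => ?_
    have h := measurable_chain_one f₁ f₂
    have e : (fun x => ((timeLaw T).map fun τ => chain f₁ f₂ τ 1 x) A) =
        fun x => timeLaw T (Prod.mk x ⁻¹'
          ((fun y : Phase f₁ f₂ × (ℕ → ℝ) => chain f₁ f₂ y.2 1 y.1) ⁻¹' A)) := by
      funext x
      exact Measure.map_apply (h.comp measurable_prodMk_left) hA
    rw [e]
    exact measurable_measure_prodMk_left (h hA)

/-- Normalized Lebesgue measure on `𝒪`. -/
def lebesgue (f₁ f₂ : S1 → ℝ) : Measure (Phase f₁ f₂) :=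
  ((volume : Measure T2) (fixedSet f₁ f₂)ᶜ)⁻¹ • (volume : Measure T2).comap Subtype.val

section Ergodicity

variable {X : Type*} [MeasurableSpace X]

/-- A stationary measure of a Markov kernel: a probability measure `μ` with `P^* μ = μ`. -/
def IsStationary (P : Kernel X X) (μ : Measure X) : Prop :=
  IsProbabilityMeasure μ ∧ P.Invariant μ

/-- Membership in `ℳ_V`: measurable functions with finite weighted norm. -/
def MemWeighted (V g : X → ℝ) : Prop :=
  Measurable g ∧ BddAbove (range fun x => |g x| / V x)

/-- The weighted norm `‖g‖_V = sup |g| / V`. -/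
def weightedNorm (V g : X → ℝ) : ℝ := ⨆ x, |g x| / V x

/-- `V`-uniform geometric ergodicity. `P ^ m` is the `m`-step kernel, so that
`P^m g (x) = ∫ g d(P ^ m)(x, ·)`; the integrals are required to exist. -/
def UniformlyGeometricallyErgodic (P : Kernel X X) (V : X → ℝ) : Prop :=
  ∃ μ : Measure X, IsStationary P μ ∧ (∀ ν : Measure X, IsStationary P ν → ν = μ) ∧
    ∃ C γ : ℝ, 0 < C ∧ 0 < γ ∧ γ < 1 ∧
      ∀ g : X → ℝ, MemWeighted V g →
        Integrable g μ ∧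
        ∀ (x : X) (m : ℕ), Integrable g ((P ^ m) x) ∧
          |∫ y, g y ∂((P ^ m) x) - ∫ y, g y ∂μ| ≤ C * V x * weightedNorm V g * γ ^ m

end Ergodicity

/-- `V(q, p) = max (d(q, C_{f₂}), d(p, C_{f₁})) ^ (-β) + b`. The distance to the empty set is `∞`
and `∞ ^ (-β) = 0`; on `𝒪` the maximum is positive, so the power is finite. -/
def lyapunov (f₁ f₂ : S1 → ℝ) (β b : ℝ) (x : Phase f₁ f₂) : ℝ :=
  ((max (Metric.infEDist x.1.1 (zeroSet f₂)) (Metric.infEDist x.1.2 (zeroSet f₁))) ^ (-β)).toReal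
    + b

end

end ShearFlow

/-! The proof is Harris' theorem in the form of Hairer and Mattingly: a drift condition for the
Lyapunov function and a minorization on a large sublevel set make the kernel contract suitably
weighted increments. This is `uniformlyGeometricallyErgodic_of_drift_of_minorization`; iterating the
contraction gives geometric convergence, and convergence forces uniqueness of the stationary
measure. Existence is free: every shear preserves Lebesgue measure.

Drift (`exists_drift`). A shear of speed `a` spreads a point uniformly over an arc of length `T|a|`,
and the average of `d(·, C)^{-β}` over it, for a finite set `C`, is at most a constant times `1 +
(T|a|)^{-β}`. Simple zeros give `|f| ≳ min(d(·, C_f), 1)`, which turns this into `T^{-β}` times the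
singular weight at the starting point. The contraction factor is therefore `O(T^{-β})`, while the
additive constant does not depend on `T`.

Minorization (`exists_minorization`). On a sublevel set of the weight one of `|f₁(p)|`, `|f₂(q)|` is
at least some `η`. For large `T` the corresponding shear winds around the circle, and the law on a
winding arc dominates a multiple of Lebesgue measure. One step reaches, with probability bounded
below, a height at which the horizontal shear winds; a second step then spreads mass in both
directions.

Since the drift constant is independent of `T`, the level `R` and then `η` are fixed before `T` is
taken large. -/

namespace ShearFlow

open MeasureTheory ProbabilityTheory Set
open scoped ENNReal

noncomputable section

/-! ### Harris' theorem: drift and minorization imply geometric ergodicity. -/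

section Harris

variable {X : Type*} [MeasurableSpace X]

/-- A function whose increments are bounded by `M (2 + κ V(x) + κ V(y))` is, up to an additive
constant, bounded by `M (1 + κ V)`. -/
theorem exists_center {X : Type*} {V φ : X → ℝ} {κ M : ℝ} [Nonempty X]
    (h : ∀ x y, |φ x - φ y| ≤ M * (2 + κ * V x + κ * V y)) :
    ∃ c, ∀ x, |φ x - c| ≤ M * (1 + κ * V x) := by
  have hb : ∀ x y, φ x - M * (1 + κ * V x) ≤ φ y + M * (1 + κ * V y) := fun x y => by
    have := (abs_le.1 (h x y)).2
    linarith
  obtain ⟨y₀⟩ := ‹Nonempty X›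
  have hbdd : BddAbove (range fun x => φ x - M * (1 + κ * V x)) :=
    ⟨φ y₀ + M * (1 + κ * V y₀), by rintro _ ⟨x, rfl⟩; exact hb x y₀⟩
  have : Nonempty X := ⟨y₀⟩
  -- By `hb` every lower barrier lies below every upper barrier, so the supremum of the lower ones
  -- separates the two families.
  refine ⟨⨆ x, (φ x - M * (1 + κ * V x)), fun x => abs_le.2 ⟨?_, ?_⟩⟩
  · have := ciSup_le fun y => hb y x
    linarith
  · have := le_ciSup hbdd x
    linarith

/-- A function bounded by a multiple of `1 + κ V` is integrable as soon as `V` is. -/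
theorem integrable_of_weighted_bound {μ : Measure X} [IsFiniteMeasure μ] {V φ : X → ℝ}
    {κ M c : ℝ} (hV : Integrable V μ) (hφ : Measurable φ)
    (h : ∀ x, |φ x - c| ≤ M * (1 + κ * V x)) : Integrable φ μ := by
  have h1 : Integrable (fun x => M * (1 + κ * V x)) μ :=
    ((integrable_const _).add (hV.const_mul _)).const_mul _
  have h2 : Integrable (fun x => φ x - c) μ :=
    h1.mono' (hφ.sub_const c).aestronglyMeasurable (ae_of_all _ h)
  exact (h2.add (integrable_const c)).congr (ae_of_all _ fun x => by simp)

theorem measurable_integral_kernel (Q : Kernel X X) {φ : X → ℝ} (hφ : Measurable φ) :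
    Measurable fun x => ∫ y, φ y ∂Q x :=
  (StronglyMeasurable.integral_kernel (κ := Q) hφ.stronglyMeasurable).measurable

/-- The Hairer–Mattingly contraction: a drift condition and a minorization on a large sublevel set
of `V` contract weighted increments. -/
theorem exists_contraction {Q : Kernel X X} [IsMarkovKernel Q] {V : X → ℝ}
    (hV0 : ∀ x, 0 ≤ V x) (hint : ∀ x, Integrable V (Q x)) {γ K R : ℝ} (hγ0 : 0 ≤ γ) (hγ1 : γ < 1)
    (hK : 0 < K) (hdrift : ∀ x, ∫ y, V y ∂Q x ≤ γ * V x + K) (hR : 2 * K < (1 - γ) * R)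
    {ν : Measure X} [IsFiniteMeasure ν] (hν : ν ≠ 0) (hmin : ∀ x, V x ≤ R → ν ≤ Q x) :
    ∃ κ a : ℝ, 0 < κ ∧ 0 < a ∧ a < 1 ∧ ∀ (φ : X → ℝ) (M : ℝ), Measurable φ → 0 ≤ M →
      (∀ x y, |φ x - φ y| ≤ M * (2 + κ * V x + κ * V y)) →
      ∀ x y, |∫ z, φ z ∂Q x - ∫ z, φ z ∂Q y| ≤ a * M * (2 + κ * V x + κ * V y) := by
  have hR0 : 0 < R := by nlinarith
  set α : ℝ := min (ν.real univ) 1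
  have hα0 : 0 < α := by
    refine lt_min ?_ one_pos
    rw [measureReal_def]
    exact ENNReal.toReal_pos (by simpa using hν) (measure_ne_top _ _)
  have hαν : α ≤ ν.real univ := min_le_left _ _
  have hα1 : α ≤ 1 := min_le_right _ _
  have h2K : 2 * K / R < 1 - γ := (div_lt_iff₀ hR0).2 hR
  set γ₀ := γ + 2 * K / R
  have hγ₀ : γ₀ < 1 := by simp only [γ₀]; linarith
  have hγ₀0 : 0 < γ₀ := by positivity
  -- With this weight the two drift constants cost `2κK = α`, half of the gain `2α` that the
  -- minorization yields at the two points.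
  set κ := α / (2 * K)
  have hκ : 0 < κ := by positivity
  have hκK : κ * K = α / 2 := by simp only [κ]; field_simp
  set a₁ := (2 + κ * (γ₀ * R)) / (2 + κ * R)
  have ha₁0 : 0 < a₁ := by positivity
  have ha₁1 : a₁ < 1 := by
    rw [div_lt_one (by positivity)]
    have : κ * (γ₀ * R) < κ * R := by
      apply mul_lt_mul_of_pos_left _ hκ; nlinarith
    linarith
  set a₂ := max (1 - α / 2) γ
  refine ⟨κ, max a₁ a₂, hκ, lt_max_of_lt_left ha₁0,
    max_lt ha₁1 (max_lt (by linarith) hγ1), ?_⟩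
  intro φ M hφ hM h x y
  have : Nonempty X := ⟨x⟩
  obtain ⟨c, hc⟩ := exists_center h
  have hφi := fun x => integrable_of_weighted_bound (hint x) hφ hc
  have hwi : ∀ x, Integrable (fun z => M * (1 + κ * V z)) (Q x) := fun x =>
    ((integrable_const _).add ((hint x).const_mul _)).const_mul _
  have hw : ∀ x, ∫ z, M * (1 + κ * V z) ∂Q x ≤ M * (1 + κ * (γ * V x + K)) := fun x => by
    rw [integral_const_mul, integral_add (integrable_const _) ((hint x).const_mul _),
      integral_const_mul]
    simp only [integral_const, probReal_univ, smul_eq_mul, mul_one]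
    have := hdrift x
    gcongr
  have e : ∀ x, ∫ z, (φ z - c) ∂Q x = ∫ z, φ z ∂Q x - c := fun x => by
    rw [integral_sub (hφi x) (integrable_const c)]; simp
  have hxy : ∫ z, φ z ∂Q x - ∫ z, φ z ∂Q y = ∫ z, (φ z - c) ∂Q x - ∫ z, (φ z - c) ∂Q y := by
    rw [e, e]; ring
  set S := V x + V y 
  have hS0 : 0 ≤ S := add_nonneg (hV0 x) (hV0 y)
  have hgoal : max a₁ a₂ * M * (2 + κ * V x + κ * V y) = M * (max a₁ a₂ * (2 + κ * S)) := by
    simp only [S]; ring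
  rw [hxy, hgoal]
  have hci : ∀ x, Integrable (fun z => φ z - c) (Q x) := fun x =>
    (hφi x).sub (integrable_const c)
  -- For `S ≥ R` drift alone suffices: `γS + 2K ≤ γ₀S`, and `(2 + κγ₀S)/(2 + κS)` decreases in `S`,
  -- hence is at most its value `a₁` at `S = R`. For `S < R` both points lie in the minorized
  -- sublevel set.
  by_cases hRS : R ≤ S
  · have hb : ∀ x, |∫ z, (φ z - c) ∂Q x| ≤ M * (1 + κ * (γ * V x + K)) := fun x =>
      (abs_integral_le_integral_abs).trans
        ((integral_mono (hci x).abs (hwi x) hc).trans (hw x))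
    have hx := hb x
    have hy := hb y
    refine (abs_sub _ _).trans ((add_le_add hx hy).trans ?_)
    rw [← mul_add]
    refine mul_le_mul_of_nonneg_left ?_ hM
    have h3 : γ * S + 2 * K ≤ γ₀ * S := by
      have : 2 * K = 2 * K / R * R := by field_simp
      have h4 : 2 * K / R * R ≤ 2 * K / R * S := by gcongr
      simp only [γ₀]; nlinarith
    have h5 : 2 + κ * (γ₀ * S) ≤ a₁ * (2 + κ * S) := by
      simp only [a₁]
      rw [div_mul_eq_mul_div (2 + κ * (γ₀ * R)), le_div_iff₀ (by positivity)]
      nlinarith [mul_nonneg hκ.le (mul_nonneg (sub_nonneg.2 hRS) (sub_nonneg.2 hγ₀.le))]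
    have h6 : a₁ * (2 + κ * S) ≤ max a₁ a₂ * (2 + κ * S) :=
      mul_le_mul_of_nonneg_right (le_max_left _ _) (by positivity)
    have h7 := mul_le_mul_of_nonneg_left h3 hκ.le
    simp only [S] at *
    linarith
  · have hx : V x ≤ R := by have := hV0 y; linarith
    have hy : V y ≤ R := by have := hV0 x; linarith
    have hνV : Integrable V ν := (hint x).mono_measure (hmin x hx)
    have hνw : ∫ z, M * (1 + κ * V z) ∂ν ≥ M * α := by
      rw [integral_const_mul, integral_add (integrable_const _) (hνV.const_mul _),
        integral_const_mul]
      simp only [integral_const, smul_eq_mul, mul_one]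
      have h0 : 0 ≤ ∫ z, V z ∂ν := integral_nonneg hV0
      have := mul_nonneg hκ.le h0
      exact mul_le_mul_of_nonneg_left (by linarith) hM
    have hνi : Integrable (fun z => φ z - c) ν := (hci x).mono_measure (hmin x hx)
    have hνwi : Integrable (fun z => M * (1 + κ * V z)) ν := (hwi x).mono_measure (hmin x hx)
    -- The common part `ν` cancels in the difference of the two integrals. Comparing `ν` with `Q x`
    -- on the nonnegative functions `M(1 + κV) ∓ (φ - c)` avoids forming `Q x - ν`.
    have hb : ∀ x, V x ≤ R → |∫ z, (φ z - c) ∂Q x - ∫ z, (φ z - c) ∂ν|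
        ≤ M * (1 + κ * (γ * V x + K)) - M * α := fun x hx => by
      have hu := integral_mono_measure (hmin x hx)
        (f := fun z => M * (1 + κ * V z) - (φ z - c))
        (ae_of_all _ fun z => sub_nonneg.2 (abs_le.1 (hc z)).2) ((hwi x).sub (hci x))
      have hl := integral_mono_measure (hmin x hx)
        (f := fun z => M * (1 + κ * V z) + (φ z - c))
        (ae_of_all _ fun z => by
          have := (abs_le.1 (hc z)).1
          change 0 ≤ M * (1 + κ * V z) + (φ z - c)
          linarith) ((hwi x).add (hci x))
      rw [integral_sub hνwi hνi, integral_sub (hwi x) (hci x)] at hu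
      rw [integral_add hνwi hνi, integral_add (hwi x) (hci x)] at hl
      have := hw x
      rw [abs_le]
      constructor <;> linarith
    have hbx := hb x hx
    have hby := hb y hy
    have key : |∫ z, (φ z - c) ∂Q x - ∫ z, (φ z - c) ∂Q y| ≤
        M * (2 + κ * (γ * S) + 2 * (κ * K) - 2 * α) := by
      rw [abs_le] at *
      constructor <;> linarith [hbx.1, hbx.2, hby.1, hby.2]
    refine key.trans (mul_le_mul_of_nonneg_left ?_ hM)
    rw [hκK]
    have h6 : a₂ * (2 + κ * S) ≤ max a₁ a₂ * (2 + κ * S) :=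
      mul_le_mul_of_nonneg_right (le_max_right _ _) (by positivity)
    have h7 : (1 - α / 2) * 2 ≤ a₂ * 2 :=
      mul_le_mul_of_nonneg_right (le_max_left _ _) (by norm_num)
    have h8 : γ * (κ * S) ≤ a₂ * (κ * S) :=
      mul_le_mul_of_nonneg_right (le_max_right _ _) (by positivity)
    linarith

theorem isMarkovKernel_pow (P : Kernel X X) [IsMarkovKernel P] (m : ℕ) :
    IsMarkovKernel (P ^ m) := by
  induction m with
  | zero => rw [pow_zero]; exact inferInstanceAs (IsMarkovKernel Kernel.id)
  | succ m ih => rw [pow_succ]; exact inferInstanceAs (IsMarkovKernel ((P ^ m) ∘ₖ P))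

theorem invariant_pow {P : Kernel X X} {μ : Measure X} (h : P.Invariant μ) (m : ℕ) :
    (P ^ m).Invariant μ := by
  induction m with
  | zero => rw [pow_zero]; exact Measure.bind_dirac
  | succ m ih => rw [pow_succ]; exact ih.comp h

theorem integral_mul_kernel {P Q : Kernel X X} {x : X} {φ : X → ℝ}
    (h : Integrable φ ((P * Q) x)) :
    ∫ z, φ z ∂(P * Q) x = ∫ y, ∫ z, φ z ∂P y ∂Q x :=
  Kernel.integral_comp (η := P) (κ := Q) h

theorem integral_invariant {P : Kernel X X} {μ : Measure X} (hinv : P.Invariant μ) {φ : X → ℝ}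
    (h : Integrable φ μ) : ∫ y, ∫ z, φ z ∂P y ∂μ = ∫ z, φ z ∂μ := by
  have e : (P ∘ₖ Kernel.const Unit μ) () = μ := by
    rw [Kernel.comp_apply, Kernel.const_apply]; exact hinv.def
  have := Kernel.integral_comp (η := P) (κ := Kernel.const Unit μ) (a := ()) (f := φ)
    (by rwa [e])
  rw [e] at this
  simpa using this.symm

/-- Under a drift condition, `V` is integrable for the composition of `P` with any kernel
integrating `V`. -/
theorem integrable_mul_kernel {P Q : Kernel X X} {V : X → ℝ} (hVm : Measurable V)
    (hV0 : ∀ x, 0 ≤ V x) {γ K : ℝ} (hint : ∀ x, Integrable V (P x))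
    (hdrift : ∀ x, ∫ y, V y ∂P x ≤ γ * V x + K) {x : X} [IsFiniteMeasure (Q x)]
    (hQ : Integrable V (Q x)) : Integrable V ((P * Q) x) := by
  refine (integrable_comp_iff (η := P) (κ := Q) hVm.aestronglyMeasurable).2
    ⟨ae_of_all _ hint, ?_⟩
  have h1 : Integrable (fun y => γ * V y + K) (Q x) :=
    (hQ.const_mul _).add (integrable_const _)
  refine h1.mono' (measurable_integral_kernel P hVm.norm).aestronglyMeasurable
    (ae_of_all _ fun y => ?_)
  simp only [Real.norm_eq_abs, abs_of_nonneg (hV0 _)]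
  rw [abs_of_nonneg (integral_nonneg hV0)]
  exact hdrift y

theorem integrable_pow_kernel {P : Kernel X X} [IsMarkovKernel P] {V : X → ℝ}
    (hVm : Measurable V) (hV0 : ∀ x, 0 ≤ V x) {γ K : ℝ} (hint : ∀ x, Integrable V (P x))
    (hdrift : ∀ x, ∫ y, V y ∂P x ≤ γ * V x + K) (m : ℕ) (x : X) :
    Integrable V ((P ^ m) x) := by
  induction m with
  | zero =>
    rw [pow_zero]
    exact integrable_dirac' hVm.stronglyMeasurable (by simp)
  | succ m ih =>
    have := isMarkovKernel_pow P m
    rw [pow_succ']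
    exact integrable_mul_kernel hVm hV0 hint hdrift ih

/-- Iterating a contraction of weighted increments gives geometric convergence. -/
theorem abs_integral_pow_sub_le {Q : Kernel X X} [IsMarkovKernel Q] {V : X → ℝ}
    (hint : ∀ m x, Integrable V ((Q ^ m) x)) {μ : Measure X} [IsProbabilityMeasure μ]
    (hinv : Q.Invariant μ) (hμV : Integrable V μ) {κ a : ℝ} (ha : 0 < a)
    (hcontr : ∀ (φ : X → ℝ) (M : ℝ), Measurable φ → 0 ≤ M →
      (∀ x y, |φ x - φ y| ≤ M * (2 + κ * V x + κ * V y)) →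
      ∀ x y, |∫ z, φ z ∂Q x - ∫ z, φ z ∂Q y| ≤ a * M * (2 + κ * V x + κ * V y))
    (m : ℕ) (x : X) (φ : X → ℝ) (M : ℝ) (hφ : Measurable φ) (hM : 0 ≤ M)
    (h : ∀ x y, |φ x - φ y| ≤ M * (2 + κ * V x + κ * V y)) :
    |∫ z, φ z ∂(Q ^ m) x - ∫ z, φ z ∂μ| ≤
      a ^ m * (M * (2 + κ * V x + κ * ∫ z, V z ∂μ)) := by
  induction m generalizing φ M with
  | zero =>
    have : Nonempty X := ⟨x⟩
    obtain ⟨c, hc⟩ := exists_center h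
    have hi : Integrable φ μ := integrable_of_weighted_bound hμV hφ hc
    have e0 : ∫ z, φ z ∂(Q ^ 0) x = φ x := by
      rw [pow_zero]
      exact integral_dirac' _ _ hφ.stronglyMeasurable
    have e : φ x - ∫ z, φ z ∂μ = ∫ z, (φ x - φ z) ∂μ := by
      rw [integral_sub (integrable_const _) hi]; simp
    rw [e0, e, pow_zero, one_mul]
    have hb : Integrable (fun z => M * (2 + κ * V x + κ * V z)) μ :=
      ((integrable_const _).add (hμV.const_mul _)).const_mul _
    refine abs_integral_le_integral_abs.trans
      ((integral_mono ((integrable_const _).sub hi).abs hb fun z => h x z).trans ?_)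
    rw [integral_const_mul, integral_add (integrable_const _) (hμV.const_mul _),
      integral_const_mul]
    simp
  | succ m ih =>
    have : Nonempty X := ⟨x⟩
    obtain ⟨c, hc⟩ := exists_center h
    have hi : Integrable φ μ := integrable_of_weighted_bound hμV hφ hc
    have := isMarkovKernel_pow Q (m + 1)
    have hi' : Integrable φ ((Q * Q ^ m) x) := by
      rw [← pow_succ']
      exact integrable_of_weighted_bound (hint _ _) hφ hc
    -- One application of `Q` is moved onto `φ`; the induction hypothesis then applies to `Qφ`,
    -- whose increment constant is `aM`.
    rw [pow_succ', integral_mul_kernel hi', ← integral_invariant hinv hi]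
    refine (ih _ (a * M) (measurable_integral_kernel Q hφ) (by positivity)
      (hcontr φ M hφ hM h)).trans_eq ?_
    ring

/-- Pointwise geometric convergence on bounded functions forces uniqueness of the stationary
measure. -/
theorem stationary_unique {P : Kernel X X} [IsMarkovKernel P] {μ ν : Measure X}
    [IsProbabilityMeasure μ] (hν : IsStationary P ν)
    (hconv : ∀ A, MeasurableSet A → ∀ x,
      Filter.Tendsto (fun m : ℕ => ((P ^ m) x).real A) Filter.atTop (nhds (μ.real A))) :
    ν = μ := by
  have := hν.1
  ext A hA
  have h1 : ∀ m, ν.real A = ∫ x, ((P ^ m) x).real A ∂ν := fun m => by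
    have := isMarkovKernel_pow P m
    have h := (invariant_pow hν.2 m).def
    have h2 : ν A = ∫⁻ x, (P ^ m) x A ∂ν := by
      conv_lhs => rw [← h]
      exact Measure.bind_apply hA (Kernel.aemeasurable _)
    simp only [measureReal_def]
    rw [h2, integral_toReal (Kernel.measurable_coe _ hA).aemeasurable
      (ae_of_all _ fun x => measure_lt_top _ _)]
  have h3 : Filter.Tendsto (fun m : ℕ => ∫ x, ((P ^ m) x).real A ∂ν) Filter.atTop
      (nhds (∫ _, μ.real A ∂ν)) := by
    refine tendsto_integral_of_dominated_convergence (fun _ => 1) (fun m => ?_)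
      (integrable_const _) (fun m => ae_of_all _ fun x => ?_) (ae_of_all _ (hconv A hA))
    · exact (Kernel.measurable_coe (P ^ m) hA).ennreal_toReal.aestronglyMeasurable
    · have := isMarkovKernel_pow P m
      rw [Real.norm_eq_abs, abs_of_nonneg measureReal_nonneg]
      exact measureReal_le_one
  have h4 : ν.real A = μ.real A := by
    have h5 : Filter.Tendsto (fun _ : ℕ => ν.real A) Filter.atTop (nhds (μ.real A)) := by
      have e : (fun _ : ℕ => ν.real A) = fun m => ∫ x, ((P ^ m) x).real A ∂ν := funext h1
      rw [e]
      simpa using h3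
    exact tendsto_nhds_unique tendsto_const_nhds h5
  exact (measureReal_eq_measureReal_iff).1 h4

/-- **Harris' theorem** for a kernel whose two-step kernel is minorized on a large sublevel set of
the Lyapunov function. -/
theorem uniformlyGeometricallyErgodic_of_drift_of_minorization {P : Kernel X X} [IsMarkovKernel P]
    {V : X → ℝ} (hVm : Measurable V) (hV1 : ∀ x, 1 ≤ V x) {γ K R : ℝ} (hγ0 : 0 ≤ γ) (hγ1 : γ < 1)
    (hK : 0 < K) (hint : ∀ x, Integrable V (P x)) (hdrift : ∀ x, ∫ y, V y ∂P x ≤ γ * V x + K)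
    (hR : 2 * K < (1 - γ) ^ 2 * R) {ν : Measure X} [IsFiniteMeasure ν] (hν : ν ≠ 0)
    (hmin : ∀ x, V x ≤ R → ν ≤ (P ^ 2) x) {μ : Measure X} (hμ : IsStationary P μ)
    (hμV : Integrable V μ) :
    (∀ ν' : Measure X, IsStationary P ν' → ν' = μ) ∧ UniformlyGeometricallyErgodic P V := by
  have hV0 : ∀ x, 0 ≤ V x := fun x => zero_le_one.trans (hV1 x)
  have hpow := integrable_pow_kernel hVm hV0 hint hdrift
  have hQM := isMarkovKernel_pow P 2
  have hμp := hμ.1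
  have hdrift2 : ∀ x, ∫ y, V y ∂(P ^ 2) x ≤ γ ^ 2 * V x + (γ + 1) * K := fun x => by
    have hi : Integrable V ((P * P) x) := by rw [← pow_two]; exact hpow 2 x
    rw [pow_two, integral_mul_kernel hi]
    have h1 : Integrable (fun y => γ * V y + K) (P x) :=
      ((hint x).const_mul _).add (integrable_const _)
    have hi' : Integrable (fun y => ∫ z, V z ∂P y) (P x) := Integrable.integral_comp hi
    refine (integral_mono hi' h1 hdrift).trans ?_
    rw [integral_add ((hint x).const_mul _) (integrable_const _), integral_const_mul]
    have := mul_le_mul_of_nonneg_left (hdrift x) hγ0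
    simp only [integral_const, probReal_univ, smul_eq_mul, one_mul]
    linarith
  have hR0 : 0 < R := by
    by_contra hR'
    have := mul_nonneg (sq_nonneg (1 - γ)) (neg_nonneg.2 (not_lt.1 hR'))
    linarith
  -- For the two-step constants the level condition reduces to `2K < (1 - γ)R`, which follows from
  -- `hR` because `(1 - γ)² ≤ 1 - γ`.
  obtain ⟨κ, a, hκ, ha0, ha1, hcontr⟩ := exists_contraction (Q := P ^ 2) hV0 (hpow 2)
    (γ := γ ^ 2) (K := (γ + 1) * K) (R := R) (by positivity) (by nlinarith) (by positivity)
    hdrift2 (by nlinarith) hν hmin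
  set I := ∫ z, V z ∂μ
  have hI : 0 ≤ I := integral_nonneg hV0
  set C₀ := 2 / κ + 1 + I
  have hC₀ : 0 < C₀ := by positivity
  have even : ∀ (g : X → ℝ) (N : ℝ), Measurable g → (∀ x, |g x| ≤ N * V x) → 0 ≤ N → ∀ m x,
      |∫ y, g y ∂(P ^ (2 * m)) x - ∫ y, g y ∂μ| ≤ C₀ * V x * N * a ^ m := by
    intro g N hg hgN hN m x
    have h := abs_integral_pow_sub_le (Q := P ^ 2) (V := V)
      (fun m x => by rw [← pow_mul]; exact hpow _ x) (invariant_pow hμ.2 2) hμV ha0 hcontr m x g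
      (N / κ) hg (by positivity) (fun x y => by
        have e : N / κ * (2 + κ * V x + κ * V y) = 2 * N / κ + N * V x + N * V y := by
          field_simp
        rw [e]
        have : 0 ≤ 2 * N / κ := by positivity
        have := abs_sub (g x) (g y)
        linarith [hgN x, hgN y])
    rw [← pow_mul] at h
    refine h.trans ?_
    rw [mul_comm]
    refine mul_le_mul_of_nonneg_right ?_ (by positivity)
    have e : N / κ * (2 + κ * V x + κ * I) = N * (2 / κ + V x + I) := by field_simp
    rw [e, mul_comm (C₀ * V x)]
    refine mul_le_mul_of_nonneg_left ?_ hN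
    have h1 : 2 / κ ≤ 2 / κ * V x := le_mul_of_one_le_right (by positivity) (hV1 x)
    have h2 : I ≤ I * V x := le_mul_of_one_le_right hI (hV1 x)
    simp only [C₀]
    linarith
  -- The factor `a` belongs to two steps, so the rate per step is its square root.
  set ρ := Real.sqrt a
  have hρ0 : 0 < ρ := Real.sqrt_pos.2 ha0
  have hρ1 : ρ < 1 := by
    rw [Real.sqrt_lt' one_pos]; simpa using ha1
  have hρa : ρ ^ 2 = a := Real.sq_sqrt ha0.le
  have hint_of : ∀ (ξ : Measure X) [IsFiniteMeasure ξ] (g : X → ℝ) (N : ℝ), Integrable V ξ →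
      Measurable g → (∀ x, |g x| ≤ N * V x) → Integrable g ξ := fun ξ _ g N hξ hg hgN =>
    (hξ.const_mul N).mono' hg.aestronglyMeasurable (ae_of_all _ hgN)
  have hconv : ∀ (g : X → ℝ) (N : ℝ), Measurable g → (∀ x, |g x| ≤ N * V x) → 0 ≤ N → ∀ x m,
      |∫ y, g y ∂(P ^ m) x - ∫ y, g y ∂μ| ≤ C₀ * (1 + γ + K) / ρ * V x * N * ρ ^ m := by
    intro g N hg hgN hN x m
    have hVx := hV0 x
    obtain ⟨k, rfl | rfl⟩ := m.even_or_odd'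
    · refine (even g N hg hgN hN k x).trans ?_
      rw [pow_mul, hρa]
      have : C₀ ≤ C₀ * (1 + γ + K) / ρ := by
        rw [le_div_iff₀ hρ0]
        have : ρ ≤ 1 + γ + K := by linarith
        gcongr
      gcongr
    -- At odd times the even estimate is applied to `Pg`, which the drift bounds by `N(γ + K)V`;
    -- dividing the constant by `ρ` pays for the extra step.
    · have := isMarkovKernel_pow P (2 * k + 1)
      have hi : Integrable g ((P * P ^ (2 * k)) x) := by
        rw [← pow_succ']
        exact hint_of _ g N (hpow _ x) hg hgN
      rw [pow_succ', integral_mul_kernel hi, ← integral_invariant hμ.2 (hint_of μ g N hμV hg hgN)]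
      refine (even (fun y => ∫ z, g z ∂P y) (N * (γ + K)) (measurable_integral_kernel P hg)
        (fun y => ?_) (by positivity) k x).trans ?_
      · refine abs_integral_le_integral_abs.trans
          ((integral_mono (hint_of _ g N (hint y) hg hgN).abs ((hint y).const_mul N) hgN).trans ?_)
        rw [integral_const_mul, mul_assoc]
        refine mul_le_mul_of_nonneg_left ((hdrift y).trans ?_) hN
        have := le_mul_of_one_le_right hK.le (hV1 y)
        linarith
      · rw [pow_succ, pow_mul, hρa]
        have e : C₀ * (1 + γ + K) / ρ * V x * N * (a ^ k * ρ)
            = C₀ * V x * (N * (1 + γ + K)) * a ^ k := by field_simp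
        rw [e]
        gcongr
        linarith
  have huniq : ∀ ν' : Measure X, IsStationary P ν' → ν' = μ := by
    intro ν' hν'
    refine stationary_unique hν' fun A hA x => ?_
    have h1 : ∀ x, |A.indicator (fun _ => (1 : ℝ)) x| ≤ 1 * V x := fun x => by
      rw [one_mul]
      refine le_trans ?_ (hV1 x)
      by_cases hx : x ∈ A <;> simp [hx]
    have h2 := hconv (A.indicator fun _ => 1) 1 (measurable_const.indicator hA) h1 zero_le_one x
    simp only [integral_indicator_const _ hA, smul_eq_mul, mul_one] at h2
    rw [tendsto_iff_dist_tendsto_zero]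
    refine squeeze_zero (fun _ => dist_nonneg) h2 ?_
    simpa using (tendsto_pow_atTop_nhds_zero_of_lt_one hρ0.le hρ1).const_mul
      (C₀ * (1 + γ + K) / ρ * V x)
  refine ⟨huniq, μ, hμ, huniq, C₀ * (1 + γ + K) / ρ, ρ, by positivity, hρ0, hρ1, ?_⟩
  rintro g ⟨hg, hbdd⟩
  have hgN : ∀ x, |g x| ≤ weightedNorm V g * V x := fun x =>
    (div_le_iff₀ (zero_lt_one.trans_le (hV1 x))).1 (le_ciSup hbdd x)
  have hN : 0 ≤ weightedNorm V g := Real.iSup_nonneg fun x => div_nonneg (abs_nonneg _) (hV0 x)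
  refine ⟨hint_of μ g _ hμV hg hgN, fun x m => ⟨?_, hconv g _ hg hgN hN x m⟩⟩
  have := isMarkovKernel_pow P m
  exact hint_of _ g _ (hpow m x) hg hgN

end Harris

/-! ### Simple zeros: finiteness and linear lower bounds. -/

section SimpleZeros

/-- At a simple zero, `f` vanishes at most linearly. -/
theorem eventually_dist_le_of_simple_zero {f : S1 → ℝ} {z : S1} (hz : f z = 0)
    (hd : circleDeriv f z ≠ 0) : ∃ c > 0, ∀ᶠ w in nhds z, c * dist w z ≤ |f w| := by
  -- `deriv` is `0` wherever the function is not differentiable, so a nonzero value entails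
  -- differentiability.
  have hdiff : DifferentiableAt ℝ (fun t : ℝ => f (z + (t : S1))) 0 :=
    differentiableAt_of_deriv_ne_zero hd
  have h := hdiff.hasDerivAt
  set d := deriv (fun t : ℝ => f (z + (t : S1))) 0
  have hd' : 0 < |d| := abs_pos.2 hd
  refine ⟨|d| / 2, by positivity, ?_⟩
  have h1 : ∀ᶠ t : ℝ in nhds 0, |d| / 2 * dist (z + (t : S1)) z ≤ |f (z + (t : S1))| := by
    rw [hasDerivAt_iff_isLittleO] at h
    filter_upwards [h.def (half_pos hd')] with t ht
    simp only [AddCircle.coe_zero, add_zero, hz, sub_zero, smul_eq_mul, Real.norm_eq_abs] at ht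
    have h2 : dist (z + (t : S1)) z ≤ |t| := by
      rw [dist_eq_norm, add_sub_cancel_left]
      exact QuotientAddGroup.norm_mk_le_norm
    have h3 : |t * d| ≤ |f (z + t)| + |d| / 2 * |t| := by
      have := abs_sub_abs_le_abs_sub (t * d) (f (z + t))
      rw [abs_sub_comm] at this
      linarith
    rw [abs_mul] at h3
    have := mul_le_mul_of_nonneg_left h2 (half_pos hd').le
    linarith
  have hmap : Filter.map (fun t : ℝ => z + (t : S1)) (nhds 0) = nhds z := by
    have hopen : IsOpenMap fun t : ℝ => z + (t : S1) :=
      (isOpenMap_add_left z).comp QuotientAddGroup.isOpenMap_coe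
    have hcont : Continuous fun t : ℝ => z + (t : S1) :=
      continuous_const.add (AddCircle.continuous_mk' _)
    have := hopen.map_nhds_eq (x := 0) hcont.continuousAt
    simpa using this
  rw [← hmap]
  exact h1

variable {f : C(S1, ℝ)}

theorem isClosed_zeroSet (f : C(S1, ℝ)) : IsClosed (zeroSet f) :=
  isClosed_eq f.continuous continuous_const

/-- The linear lower bound isolates each zero, and the circle is compact. -/
theorem finite_zeroSet (h : zeroSet f ∩ zeroSet (circleDeriv f) = ∅) : (zeroSet f).Finite := by
  have hS : (univ ∩ zeroSet f).Finite := by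
    refine (isCompact_univ (X := S1)).induction_on (p := fun s => (s ∩ zeroSet f).Finite) (by simp)
      (fun s t hst ht => ht.subset (inter_subset_inter_left _ hst))
      (fun s t hs ht => by rw [union_inter_distrib_right]; exact hs.union ht) fun z _ => ?_
    simp only [nhdsWithin_univ]
    by_cases hz : f z = 0
    · obtain ⟨c, hc, hev⟩ := eventually_dist_le_of_simple_zero hz
        (fun h0 => (h ▸ (⟨hz, h0⟩ : z ∈ zeroSet f ∩ zeroSet (circleDeriv f)) : z ∈ (∅ : Set S1)))
      refine ⟨_, hev, (finite_singleton z).subset ?_⟩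
      rintro w ⟨hw, hw0⟩
      have hw0 : f w = 0 := hw0
      have hw : c * dist w z ≤ |f w| := hw
      rw [hw0, abs_zero] at hw
      exact dist_le_zero.1 (by nlinarith [dist_nonneg (x := w) (y := z)])
    · refine ⟨_, f.continuous.continuousAt.eventually_ne hz, ?_⟩
      convert finite_empty
      ext w
      simp only [mem_inter_iff, mem_ofPred_eq, mem_empty_iff_false, iff_false, not_and]
      exact fun a b => a b
  simpa using hS

/-- A function with simple zeros is bounded below by the distance to its zero set. -/
theorem exists_infEDist_le (h : zeroSet f ∩ zeroSet (circleDeriv f) = ∅) :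
    ∃ c : ℝ, 0 < c ∧ ∀ z,
      ENNReal.ofReal c * min (Metric.infEDist z (zeroSet f)) 1 ≤ ENNReal.ofReal |f z| := by
  have key : ∃ c : ℝ, 0 < c ∧ ∀ z ∈ (univ : Set S1),
      ENNReal.ofReal c * min (Metric.infEDist z (zeroSet f)) 1 ≤ ENNReal.ofReal |f z| := by
    refine (isCompact_univ (X := S1)).induction_on (p := fun s => ∃ c : ℝ, 0 < c ∧ ∀ z ∈ s,
      ENNReal.ofReal c * min (Metric.infEDist z (zeroSet f)) 1 ≤ ENNReal.ofReal |f z|)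
      ⟨1, one_pos, by simp⟩ (fun s t hst ⟨c, hc, ht⟩ => ⟨c, hc, fun z hz => ht z (hst hz)⟩) ?_ ?_
    · rintro s t ⟨c, hc, hs⟩ ⟨c', hc', ht⟩
      refine ⟨min c c', lt_min hc hc', fun z hz => ?_⟩
      rcases hz with hz | hz
      · exact le_trans (by gcongr; exact min_le_left _ _) (hs z hz)
      · exact le_trans (by gcongr; exact min_le_right _ _) (ht z hz)
    intro z _
    simp only [nhdsWithin_univ]
    by_cases hz : f z = 0
    · obtain ⟨c, hc, hev⟩ := eventually_dist_le_of_simple_zero hz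
        (fun h0 => (h ▸ (⟨hz, h0⟩ : z ∈ zeroSet f ∩ zeroSet (circleDeriv f)) : z ∈ (∅ : Set S1)))
      refine ⟨_, hev, c, hc, fun w hw => ?_⟩
      have hw : c * dist w z ≤ |f w| := hw
      calc ENNReal.ofReal c * min (Metric.infEDist w (zeroSet f)) 1
          ≤ ENNReal.ofReal c * edist w z := by
            gcongr
            exact (min_le_left _ _).trans (Metric.infEDist_le_edist_of_mem hz)
        _ = ENNReal.ofReal (c * dist w z) := by
            rw [edist_dist, ENNReal.ofReal_mul hc.le]
        _ ≤ _ := ENNReal.ofReal_le_ofReal hw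
    -- Truncating the distance at `1` settles this case, including an empty zero set, where the
    -- distance is `∞`.
    · have hz' : 0 < |f z| := abs_pos.2 hz
      have hev : ∀ᶠ w in nhds z, |f z| / 2 < |f w| :=
        f.continuous.abs.continuousAt.eventually_const_lt (half_lt_self hz')
      refine ⟨_, hev, |f z| / 2, half_pos hz', fun w hw => ?_⟩
      have hw : |f z| / 2 < |f w| := hw
      calc _ ≤ ENNReal.ofReal (|f z| / 2) * 1 := by gcongr; exact min_le_right _ _
        _ ≤ _ := by rw [mul_one]; exact ENNReal.ofReal_le_ofReal hw.le
  obtain ⟨c, hc, hk⟩ := key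
  exact ⟨c, hc, fun z => hk z (mem_univ z)⟩

end SimpleZeros

/-! ### The law of a sheared coordinate compared with Lebesgue measure. -/

section Arc

/-- The uniform distribution on `[0, T]`. -/
def unif (T : ℝ) : Measure ℝ := ProbabilityTheory.cond volume (Icc 0 T)

theorem isProbabilityMeasure_unif {T : ℝ} (hT : 0 < T) : IsProbabilityMeasure (unif T) := by
  exact cond_isProbabilityMeasure_of_finite (by simp [hT]) (by simp)

theorem unif_apply {T : ℝ} (hT : 0 < T) (s : Set ℝ) :
    unif T s = ENNReal.ofReal T⁻¹ * volume (Icc 0 T ∩ s) := by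
  rw [unif, cond_apply measurableSet_Icc, Real.volume_Icc, sub_zero, ENNReal.ofReal_inv_of_pos hT]

/-- The law of `s + τ a` on the circle, for `τ` uniform on `[0, T]`. -/
def arc (T : ℝ) (s : S1) (a : ℝ) : Measure S1 :=
  (unif T).map fun τ : ℝ => s + ((τ * a : ℝ) : S1)

theorem continuous_arc_map (s : S1) (a : ℝ) :
    Continuous fun τ : ℝ => s + ((τ * a : ℝ) : S1) :=
  continuous_const.add ((AddCircle.continuous_mk' _).comp (continuous_id.mul continuous_const))

/-- A `2π`-periodic set meets an interval of `n` periods in `n` times its measure per period. -/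
theorem volume_periods_inter (c : ℝ) (n : ℕ) {A : Set S1} (hA : MeasurableSet A) :
    volume (Ioc c (c + n * (2 * Real.pi)) ∩ (fun u : ℝ => (u : S1)) ⁻¹' A) = n * volume A := by
  have hm : MeasurableSet ((fun u : ℝ => (u : S1)) ⁻¹' A) := AddCircle.measurable_mk' hA
  induction n with
  | zero => simp
  | succ n ih =>
    have h0 : Ioc c (c + (n + 1 : ℕ) * (2 * Real.pi)) = Ioc c (c + n * (2 * Real.pi)) ∪
        Ioc (c + n * (2 * Real.pi)) (c + n * (2 * Real.pi) + 2 * Real.pi) := by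
      rw [Ioc_union_Ioc_eq_Ioc]
      · push_cast; ring_nf
      · have := Real.two_pi_pos; have : (0 : ℝ) ≤ n * (2 * Real.pi) := by positivity
        linarith
      · linarith [Real.two_pi_pos]
    rw [h0, union_inter_distrib_right, measure_union _ (measurableSet_Ioc.inter hm), ih,
      inter_comm (Ioc (c + n * (2 * Real.pi)) _)]
    · have := AddCircle.add_projection_respects_measure (2 * Real.pi) (c + n * (2 * Real.pi)) hA
      have e : volume ((fun u : ℝ => (u : S1)) ⁻¹' A ∩
          Ioc (c + n * (2 * Real.pi)) (c + n * (2 * Real.pi) + 2 * Real.pi)) = volume A := this.symm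
      rw [e]
      push_cast
      ring
    · refine disjoint_left.2 ?_
      rintro x ⟨hx, _⟩ ⟨hx', _⟩
      exact absurd hx.2 (not_le.2 hx'.1)

/-- The substitution `u = τa` lifts the arc to an interval of length `T|a|`. Its left end is `min 0
(T * a)` for either sign of `a`, and the base point `s` is absorbed by translating `A`. -/
theorem exists_arc_apply {T : ℝ} (hT : 0 < T) (s : S1) {a : ℝ} (ha : a ≠ 0) {A : Set S1}
    (hA : MeasurableSet A) :
    ∃ c : ℝ, ∃ B : Set S1, MeasurableSet B ∧ volume B = volume A ∧
      arc T s a A = ENNReal.ofReal (T * |a|)⁻¹ *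
        volume (Icc c (c + T * |a|) ∩ (fun u : ℝ => (u : S1)) ⁻¹' B) := by
  refine ⟨min 0 (T * a), (fun z => s + z) ⁻¹' A, measurable_const_add s hA,
    measure_preimage_add _ _ _, ?_⟩
  rw [arc, Measure.map_apply (continuous_arc_map s a).measurable hA, unif_apply hT]
  have e : Icc 0 T ∩ (fun τ : ℝ => s + ((τ * a : ℝ) : S1)) ⁻¹' A =
      (fun τ : ℝ => τ * a) ⁻¹' (Icc (min 0 (T * a)) (min 0 (T * a) + T * |a|) ∩
        (fun u : ℝ => (u : S1)) ⁻¹' ((fun z => s + z) ⁻¹' A)) := by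
    rw [preimage_inter]
    congr 1
    ext τ
    simp only [mem_Icc, mem_preimage]
    rcases lt_or_gt_of_ne ha with h | h
    · rw [abs_of_neg h, min_eq_right (mul_nonpos_of_nonneg_of_nonpos hT.le h.le)]
      constructor
      · rintro ⟨h1, h2⟩; constructor <;> nlinarith
      · rintro ⟨h1, h2⟩; constructor <;> nlinarith
    · rw [abs_of_pos h, min_eq_left (by positivity)]
      constructor
      · rintro ⟨h1, h2⟩; constructor <;> nlinarith
      · rintro ⟨h1, h2⟩; constructor <;> nlinarith
  rw [e, Real.volume_preimage_mul_right ha, ← mul_assoc, abs_inv, ← ENNReal.ofReal_mul (by positivity),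
    mul_inv]

/-- The lifted interval of length `L` is covered by `n = ⌈L/2π⌉` periods, and `n/L ≤ 1 + 1/L`. The
term `1/L` is the density of a short arc. -/
theorem arc_le {T : ℝ} (hT : 0 < T) (s : S1) {a : ℝ} (ha : a ≠ 0) :
    arc T s a ≤ ENNReal.ofReal (1 + (T * |a|)⁻¹) • volume := by
  refine Measure.le_iff.2 fun A hA => ?_
  obtain ⟨c, B, hB, hBA, h⟩ := exists_arc_apply hT s ha hA
  have hL : 0 < T * |a| := mul_pos hT (abs_pos.2 ha)
  set L := T * |a|
  set n := ⌈L / (2 * Real.pi)⌉₊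
  have hn : L ≤ n * (2 * Real.pi) := (div_le_iff₀ Real.two_pi_pos).1 (Nat.le_ceil _)
  have hn' : (n : ℝ) ≤ L + 1 := by
    refine (Nat.ceil_lt_add_one (by positivity)).le.trans ?_
    have : L / (2 * Real.pi) ≤ L := div_le_self hL.le (by linarith [Real.pi_gt_three])
    linarith
  rw [h, Measure.smul_apply, smul_eq_mul]
  have h1 : volume (Icc c (c + L) ∩ (fun u : ℝ => (u : S1)) ⁻¹' B) ≤ n * volume A := by
    rw [← hBA, ← volume_periods_inter c n hB]
    have hae : (Icc c (c + L) ∩ (fun u : ℝ => (u : S1)) ⁻¹' B : Set ℝ) =ᵐ[volume]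
        (Ioc c (c + L) ∩ (fun u : ℝ => (u : S1)) ⁻¹' B : Set ℝ) :=
      Ioc_ae_eq_Icc.symm.inter (ae_eq_refl _)
    rw [measure_congr hae]
    refine measure_mono (inter_subset_inter_left _ (Ioc_subset_Ioc_right ?_))
    linarith
  refine (mul_le_mul_right h1 _).trans ?_
  rw [← mul_assoc]
  gcongr
  rw [← ENNReal.ofReal_natCast, ← ENNReal.ofReal_mul (by positivity)]
  refine ENNReal.ofReal_le_ofReal ?_
  calc L⁻¹ * n ≤ L⁻¹ * (L + 1) := by gcongr
    _ = 1 + L⁻¹ := by field_simp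

/-- An interval of length `L ≥ 2π` contains `n = ⌊L/2π⌋ ≥ 1` full periods, and `L/2π < n + 1 ≤ 2n`
gives `n/L ≥ 1/(4π)`. -/
theorem le_arc {T : ℝ} (hT : 0 < T) (s : S1) {a : ℝ} (ha : 2 * Real.pi ≤ T * |a|) :
    ENNReal.ofReal (1 / (4 * Real.pi)) • volume ≤ arc T s a := by
  refine Measure.le_iff.2 fun A hA => ?_
  have hpi := Real.pi_pos
  have ha0 : a ≠ 0 := by rintro rfl; simp at ha; linarith
  obtain ⟨c, B, hB, hBA, h⟩ := exists_arc_apply hT s ha0 hA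
  have hL : 0 < T * |a| := mul_pos hT (abs_pos.2 ha0)
  set L := T * |a|
  set n := ⌊L / (2 * Real.pi)⌋₊
  have hn : n * (2 * Real.pi) ≤ L :=
    (le_div_iff₀ Real.two_pi_pos).1 (Nat.floor_le (by positivity))
  have h1n : (1 : ℝ) ≤ n := by
    exact_mod_cast (Nat.one_le_floor_iff _).2 ((one_le_div Real.two_pi_pos).2 ha)
  have hn' : L / (2 * Real.pi) ≤ 2 * n := by
    have := Nat.lt_floor_add_one (L / (2 * Real.pi))
    change L / (2 * Real.pi) < (n : ℝ) + 1 at this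
    linarith
  rw [h, Measure.smul_apply, smul_eq_mul]
  have h1 : n * volume A ≤ volume (Icc c (c + L) ∩ (fun u : ℝ => (u : S1)) ⁻¹' B) := by
    rw [← hBA, ← volume_periods_inter c n hB]
    refine measure_mono (inter_subset_inter_left _ (Ioc_subset_Icc_self.trans
      (Icc_subset_Icc_right ?_)))
    linarith
  refine le_trans ?_ (mul_le_mul_right h1 _)
  rw [← mul_assoc]
  gcongr
  rw [← ENNReal.ofReal_natCast, ← ENNReal.ofReal_mul (by positivity)]
  refine ENNReal.ofReal_le_ofReal ?_
  rw [div_le_iff₀ Real.two_pi_pos] at hn'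
  rw [div_le_iff₀ (by positivity), inv_mul_eq_div, div_mul_eq_mul_div, le_div_iff₀ hL]
  linarith

end Arc

/-! ### Averages of negative powers of the distance along arcs. -/

section Singular

theorem rpow_neg_anti {x y : ℝ≥0∞} (h : x ≤ y) {β : ℝ} (hβ : 0 ≤ β) : y ^ (-β) ≤ x ^ (-β) := by
  rw [ENNReal.rpow_neg, ENNReal.rpow_neg]
  exact ENNReal.inv_le_inv.2 (ENNReal.rpow_le_rpow h hβ)

theorem lintegral_Ioc_rpow_neg {β r : ℝ} (hβ1 : β < 1) (hr : 0 < r) :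
    ∫⁻ u in Ioc 0 r, ENNReal.ofReal u ^ (-β) = ENNReal.ofReal (r ^ (1 - β) / (1 - β)) := by
  have h1 : ∫⁻ u in Ioc 0 r, ENNReal.ofReal u ^ (-β) = ∫⁻ u in Ioc 0 r, ENNReal.ofReal (u ^ (-β)) :=
    setLIntegral_congr_fun measurableSet_Ioc fun u hu => ENNReal.ofReal_rpow_of_pos hu.1
  have hi : IntegrableOn (fun u : ℝ => u ^ (-β)) (Ioc 0 r) := by
    rw [← intervalIntegrable_iff_integrableOn_Ioc_of_le hr.le]
    exact intervalIntegral.intervalIntegrable_rpow' (by linarith)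
  rw [h1, ← ofReal_integral_eq_lintegral_ofReal hi
    ((ae_restrict_iff' measurableSet_Ioc).2 (ae_of_all _ fun u hu => Real.rpow_nonneg hu.1.le _)),
    ← intervalIntegral.integral_of_le hr.le, integral_rpow (Or.inl (by linarith)),
    Real.zero_rpow (by linarith)]
  congr 1
  ring_nf

/-- Integrability of a negative power of the distance on the circle, on balls. -/
theorem lintegral_ball_edist_rpow_neg_le {β r : ℝ} (hβ1 : β < 1) (hr : 0 < r)
    (z : S1) :
    ∫⁻ w, {w | edist w z < ENNReal.ofReal r}.indicator (fun w => edist w z ^ (-β)) w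
      ≤ ENNReal.ofReal (2 * (r ^ (1 - β) / (1 - β))) := by
  set F : S1 → ℝ≥0∞ := fun w => {w : S1 | ‖w‖ₑ < ENNReal.ofReal r}.indicator (fun w => ‖w‖ₑ ^ (-β)) w
  set H : ℝ → ℝ≥0∞ := (Ioc 0 r).indicator fun u => ENNReal.ofReal u ^ (-β)
  have hHm : Measurable H := (by fun_prop : Measurable fun u : ℝ => ENNReal.ofReal u ^ (-β)).indicator
    measurableSet_Ioc
  have hH : ∫⁻ u, H u = ENNReal.ofReal (r ^ (1 - β) / (1 - β)) := by
    rw [lintegral_indicator measurableSet_Ioc, lintegral_Ioc_rpow_neg hβ1 hr]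
  have e1 : ∫⁻ w, {w | edist w z < ENNReal.ofReal r}.indicator (fun w => edist w z ^ (-β)) w
      = ∫⁻ w, F (w - z) := by
    refine lintegral_congr fun w => ?_
    simp only [F, indicator_apply, mem_ofPred_eq, edist_eq_enorm_sub]
  rw [e1, lintegral_sub_right_eq_self F z, ← AddCircle.lintegral_preimage (2 * Real.pi) (-Real.pi) F]
  -- On `(-π, π]` the circle norm is `|u|`, so off the null set `{0}` the integrand splits into a
  -- right and a left half.
  have hle : ∀ᵐ u : ℝ ∂(volume.restrict (Ioc (-Real.pi) (-Real.pi + 2 * Real.pi))),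
      F (u : S1) ≤ H u + H (-u) := by
    have h0 : ∀ᵐ u : ℝ ∂(volume.restrict (Ioc (-Real.pi) (-Real.pi + 2 * Real.pi))), u ≠ (0 : ℝ) :=
      ae_restrict_of_ae (Measure.ae_ne volume 0)
    filter_upwards [h0, ae_restrict_mem measurableSet_Ioc] with u hu0 hu
    have hpi := Real.pi_pos
    have hn : ‖(u : S1)‖ = |u| := by
      refine (AddCircle.norm_coe_eq_abs_iff (p := 2 * Real.pi) (by positivity)).2 ?_
      rw [abs_of_pos Real.two_pi_pos, abs_le]
      constructor <;> linarith [hu.1, hu.2]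
    have hn' : ‖(u : S1)‖ₑ = ENNReal.ofReal |u| := by rw [← ofReal_norm, hn]
    simp only [F, H, indicator_apply, mem_ofPred_eq, hn', ENNReal.ofReal_lt_ofReal_iff hr]
    split_ifs with h1 h2 h3 h3 h2 h3 h3
    all_goals first | exact zero_le | skip
    · rw [abs_of_pos h2.1]; exact le_self_add
    · rw [abs_of_pos h2.1]; exact le_self_add
    · rw [abs_of_neg (by linarith [h3.1] : u < 0)]; exact le_add_self
    · exfalso
      rcases lt_or_gt_of_ne hu0 with h | h
      · rw [abs_of_neg h] at h1
        exact h3 ⟨by linarith, h1.le⟩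
      · rw [abs_of_pos h] at h1
        exact h2 ⟨h, h1.le⟩
  refine (lintegral_mono_ae hle).trans ((setLIntegral_le_lintegral _ _).trans ?_)
  rw [lintegral_add_left hHm, lintegral_neg_eq_self, hH, ← two_mul,
    ENNReal.ofReal_mul (by norm_num)]
  simp

/-- The far part is bounded under any probability law; only the near part needs a density bound. -/
theorem rpow_neg_le_add_indicator {β : ℝ} (hβ : 0 ≤ β) (d r : ℝ≥0∞) :
    d ^ (-β) ≤ r ^ (-β) + {d : ℝ≥0∞ | d < r}.indicator (fun d => d ^ (-β)) d := by
  by_cases h : d < r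
  · simp [h]
  · exact (rpow_neg_anti (not_lt.1 h) hβ).trans le_self_add

/-- The average of `d(·, z)^{-β}` along an arc of length `T |a|`. -/
theorem lintegral_arc_edist_rpow_neg_le {β : ℝ} (hβ0 : 0 < β) (hβ1 : β < 1) {T : ℝ} (hT : 0 < T)
    (s z : S1) (a : ℝ) :
    ∫⁻ w, edist w z ^ (-β) ∂(arc T s a) ≤
      ENNReal.ofReal (1 + 4 / (1 - β)) * (1 + ENNReal.ofReal (T * |a|) ^ (-β)) := by
  have hD : 0 < 1 - β := by linarith
  by_cases ha : a = 0
  · subst ha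
    have : ENNReal.ofReal (T * |(0 : ℝ)|) ^ (-β) = ∞ := by
      simp [ENNReal.zero_rpow_of_neg (neg_lt_zero.2 hβ0)]
    rw [this, add_top, ENNReal.mul_top]
    · exact le_top
    · simp only [ne_eq, ENNReal.ofReal_eq_zero, not_le]; positivity
  have hL : 0 < T * |a| := mul_pos hT (abs_pos.2 ha)
  set L := T * |a| with hLdef
  have hmain : ∀ r : ℝ, 0 < r → ∫⁻ w, edist w z ^ (-β) ∂(arc T s a) ≤
      ENNReal.ofReal (r ^ (-β) + (1 + L⁻¹) * (2 * (r ^ (1 - β) / (1 - β)))) := by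
    intro r hr
    have hP : IsProbabilityMeasure (arc T s a) := by
      have := isProbabilityMeasure_unif hT
      exact Measure.isProbabilityMeasure_map (continuous_arc_map s a).aemeasurable
    calc ∫⁻ w, edist w z ^ (-β) ∂(arc T s a)
        ≤ ∫⁻ w, (ENNReal.ofReal r ^ (-β) + {w | edist w z < ENNReal.ofReal r}.indicator
            (fun w => edist w z ^ (-β)) w) ∂(arc T s a) :=
          lintegral_mono fun w => rpow_neg_le_add_indicator hβ0.le _ _
      _ = ENNReal.ofReal (r ^ (-β)) + ∫⁻ w, {w | edist w z < ENNReal.ofReal r}.indicator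
            (fun w => edist w z ^ (-β)) w ∂(arc T s a) := by
          rw [lintegral_add_left measurable_const, lintegral_const, measure_univ, mul_one,
            ENNReal.ofReal_rpow_of_pos hr]
      _ ≤ ENNReal.ofReal (r ^ (-β)) + ENNReal.ofReal (1 + L⁻¹) *
            ENNReal.ofReal (2 * (r ^ (1 - β) / (1 - β))) := by
          gcongr
          refine (lintegral_mono' (arc_le hT s ha) le_rfl).trans ?_
          rw [lintegral_smul_measure, smul_eq_mul]
          gcongr
          exact lintegral_ball_edist_rpow_neg_le hβ1 hr z
      _ = _ := by
          rw [← ENNReal.ofReal_mul (by positivity), ← ENNReal.ofReal_add (by positivity)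
            (by positivity)]
  rw [ENNReal.ofReal_rpow_of_pos hL, ← ENNReal.ofReal_one,
    ← ENNReal.ofReal_add zero_le_one (by positivity), ← ENNReal.ofReal_mul (by positivity)]
  have hp : 0 < L ^ (-β) := by positivity
  have hq : 0 < 4 / (1 - β) := by positivity
  -- The cut-off radius is `min(L, 1)`. On a short arc the density `1 + 1/L` against `L^{1-β}` gives
  -- order `L^{-β}`; on a long arc the density is at most `2` and `r = 1` gives a constant.
  rcases le_total L 1 with h | h
  · refine (hmain L hL).trans (ENNReal.ofReal_le_ofReal ?_)
    have e : L ^ (1 - β) = L * L ^ (-β) := by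
      rw [sub_eq_add_neg, Real.rpow_add hL, Real.rpow_one]
    have e2 : (1 + L⁻¹) * (2 * (L ^ (1 - β) / (1 - β))) = (L + 1) * 2 / (1 - β) * L ^ (-β) := by
      rw [e]; field_simp
    have e3 : (L + 1) * 2 / (1 - β) ≤ 4 / (1 - β) := by gcongr; linarith
    rw [e2]
    nlinarith [mul_le_mul_of_nonneg_right e3 hp.le]
  · refine (hmain 1 one_pos).trans (ENNReal.ofReal_le_ofReal ?_)
    have hinv : L⁻¹ ≤ 1 := inv_le_one_of_one_le₀ h
    rw [Real.one_rpow, Real.one_rpow]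
    have e3 : (1 + L⁻¹) * (2 * (1 / (1 - β))) ≤ 4 / (1 - β) := by
      rw [← mul_assoc, mul_one_div]
      gcongr; linarith
    nlinarith

/-- On a finite set, the distance to the set is dominated by the sum of distances to its points. -/
theorem infEDist_rpow_neg_le_sum {β : ℝ} (hβ0 : 0 < β) {C : Set S1} (hC : C.Finite) (w : S1) :
    Metric.infEDist w C ^ (-β) ≤ ∑ z ∈ hC.toFinset, edist w z ^ (-β) := by
  rcases C.eq_empty_or_nonempty with rfl | hne
  · simp [ENNReal.top_rpow_of_neg (neg_lt_zero.2 hβ0)]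
  · obtain ⟨z, hz, e⟩ := hC.isCompact.exists_infEDist_eq_edist hne w
    rw [e]
    exact Finset.single_le_sum (f := fun z => edist w z ^ (-β)) (fun _ _ => zero_le)
      (hC.mem_toFinset.2 hz)

theorem measurable_infEDist_rpow (C : Set S1) (β : ℝ) :
    Measurable fun w : S1 => Metric.infEDist w C ^ (-β) :=
  Metric.continuous_infEDist.measurable.pow_const _

theorem lintegral_infEDist_rpow_neg_lt_top {β : ℝ} (hβ0 : 0 < β) (hβ1 : β < 1) {C : Set S1}
    (hC : C.Finite) : ∫⁻ w, Metric.infEDist w C ^ (-β) < ∞ := by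
  refine (lintegral_mono (infEDist_rpow_neg_le_sum hβ0 hC)).trans_lt ?_
  rw [lintegral_finsetSum _ fun z _ => (by fun_prop)]
  refine ENNReal.sum_lt_top.2 fun z _ => ?_
  refine (lintegral_mono fun w => rpow_neg_le_add_indicator hβ0.le _ (ENNReal.ofReal 1)).trans_lt ?_
  rw [lintegral_add_left measurable_const]
  refine ENNReal.add_lt_top.2 ⟨?_, ?_⟩
  · rw [lintegral_const, ENNReal.ofReal_one, ENNReal.one_rpow, one_mul]
    exact measure_lt_top _ _
  · exact (lintegral_ball_edist_rpow_neg_le hβ1 one_pos z).trans_lt ENNReal.ofReal_lt_top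

theorem exists_lintegral_unif_le {β : ℝ} (hβ0 : 0 < β) (hβ1 : β < 1) {C : Set S1}
    (hC : C.Finite) : ∃ A : ℝ≥0∞, A ≠ ∞ ∧ ∀ T : ℝ, 0 < T → ∀ (s : S1) (a : ℝ),
      ∫⁻ v, Metric.infEDist (s + ((v * a : ℝ) : S1)) C ^ (-β) ∂(unif T) ≤
        A * (1 + ENNReal.ofReal (T * |a|) ^ (-β)) := by
  refine ⟨hC.toFinset.card * ENNReal.ofReal (1 + 4 / (1 - β)),
    ENNReal.mul_ne_top (by simp) (by simp), fun T hT s a => ?_⟩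
  have e : ∫⁻ v, Metric.infEDist (s + ((v * a : ℝ) : S1)) C ^ (-β) ∂(unif T) =
      ∫⁻ w, Metric.infEDist w C ^ (-β) ∂(arc T s a) := by
    rw [arc, lintegral_map (measurable_infEDist_rpow C β) (continuous_arc_map s a).measurable]
  rw [e]
  refine (lintegral_mono (infEDist_rpow_neg_le_sum hβ0 hC)).trans ?_
  rw [lintegral_finsetSum _ fun z _ => (by fun_prop)]
  refine (Finset.sum_le_sum fun z _ =>
    lintegral_arc_edist_rpow_neg_le hβ0 hβ1 hT s z a).trans_eq ?_
  rw [Finset.sum_const, nsmul_eq_mul, mul_assoc]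

theorem ae_unif_mem {T : ℝ} : ∀ᵐ v ∂(unif T), v ∈ Icc 0 T :=
  ae_cond_mem measurableSet_Icc

/-- Let `d` be the distance from `s` to `C`. If `T|a| ≥ d/2`, the bound by `(T|a|)^{-β}` is already
good enough; otherwise the arc is too short to come within `d/2` of `C`. The result is uniform in
`a`, so it covers a horizontal shear that nearly vanishes. -/
theorem exists_lintegral_unif_le_infEDist {β : ℝ} (hβ0 : 0 < β) (hβ1 : β < 1) {C : Set S1}
    (hC : C.Finite) : ∃ A : ℝ≥0∞, A ≠ ∞ ∧ ∀ T : ℝ, 0 < T → ∀ (s : S1) (a : ℝ),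
      ∫⁻ v, Metric.infEDist (s + ((v * a : ℝ) : S1)) C ^ (-β) ∂(unif T) ≤
        A * (1 + Metric.infEDist s C ^ (-β)) := by
  obtain ⟨A, hA, h⟩ := exists_lintegral_unif_le hβ0 hβ1 hC
  refine ⟨(A + 1) * 2 ^ β, ENNReal.mul_ne_top (by simp [hA])
    (ENNReal.rpow_ne_top_of_nonneg hβ0.le (by simp)), fun T hT s a => ?_⟩
  set d := Metric.infEDist s C with hd
  have h2 : (1 : ℝ≥0∞) ≤ 2 ^ β := ENNReal.one_le_rpow (by norm_num) hβ0
  have hhalf : (d / 2) ^ (-β) = 2 ^ β * d ^ (-β) := by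
    rw [ENNReal.rpow_neg, ENNReal.div_rpow_of_nonneg _ _ hβ0.le, ENNReal.rpow_neg,
      ENNReal.inv_div (Or.inl (ENNReal.rpow_ne_top_of_nonneg hβ0.le (by simp)))
        (Or.inl (by positivity)), ENNReal.div_eq_inv_mul, mul_comm]
  rcases le_total (d / 2) (ENNReal.ofReal (T * |a|)) with hle | hle
  · refine (h T hT s a).trans ?_
    calc A * (1 + ENNReal.ofReal (T * |a|) ^ (-β)) ≤ (A + 1) * (2 ^ β * 1 + 2 ^ β * d ^ (-β)) := by
          gcongr
          · exact le_self_add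
          · rwa [mul_one]
          · exact (rpow_neg_anti hle hβ0.le).trans_eq hhalf
      _ = _ := by ring
  · have := isProbabilityMeasure_unif hT
    rcases C.eq_empty_or_nonempty with rfl | hne
    · simp [ENNReal.top_rpow_of_neg (neg_lt_zero.2 hβ0)]
    have hdtop : d ≠ ∞ := Metric.infEDist_ne_top hne
    calc ∫⁻ v, Metric.infEDist (s + ((v * a : ℝ) : S1)) C ^ (-β) ∂(unif T)
        ≤ ∫⁻ v, (d / 2) ^ (-β) ∂(unif T) := by
          refine lintegral_mono_ae ?_
          filter_upwards [ae_unif_mem] with v hv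
          refine rpow_neg_anti ?_ hβ0.le
          have h1 : d ≤ Metric.infEDist (s + ((v * a : ℝ) : S1)) C +
              edist s (s + ((v * a : ℝ) : S1)) := Metric.infEDist_le_infEDist_add_edist
          have h3 : edist s (s + ((v * a : ℝ) : S1)) ≤ d / 2 := by
            refine le_trans ?_ hle
            rw [edist_comm, edist_dist, dist_eq_norm, add_sub_cancel_left]
            refine ENNReal.ofReal_le_ofReal (QuotientAddGroup.norm_mk_le_norm.trans ?_)
            rw [Real.norm_eq_abs, abs_mul, abs_of_nonneg hv.1]
            exact mul_le_mul_of_nonneg_right hv.2 (abs_nonneg _)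
          have h4 : d / 2 + d / 2 ≤ Metric.infEDist (s + ((v * a : ℝ) : S1)) C + d / 2 := by
            rw [ENNReal.add_halves]
            exact h1.trans (by gcongr)
          exact (ENNReal.add_le_add_iff_right
            (ENNReal.div_ne_top hdtop (by norm_num))).1 h4
      _ = 2 ^ β * d ^ (-β) := by rw [lintegral_const, measure_univ, mul_one, hhalf]
      _ ≤ (A + 1) * 2 ^ β * (1 + d ^ (-β)) := by
          gcongr
          · exact le_mul_of_one_le_left (zero_le) le_add_self
          · exact le_add_self

/-- Negative powers of a function with simple zeros are controlled by the distance to the zeros. -/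
theorem exists_rpow_neg_le {f : C(S1, ℝ)} (h : zeroSet f ∩ zeroSet (circleDeriv f) = ∅) {β : ℝ}
    (hβ0 : 0 < β) : ∃ M : ℝ≥0∞, M ≠ ∞ ∧ ∀ T : ℝ, 0 < T → ∀ z,
      ENNReal.ofReal (T * |f z|) ^ (-β) ≤
        ENNReal.ofReal T ^ (-β) * (M * (1 + Metric.infEDist z (zeroSet f) ^ (-β))) := by
  obtain ⟨c, hc, hcf⟩ := exists_infEDist_le h
  refine ⟨ENNReal.ofReal c ^ (-β), by simp [ENNReal.ofReal_rpow_of_pos hc], fun T hT z => ?_⟩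
  have hm : min (Metric.infEDist z (zeroSet f)) 1 ≠ ∞ := ne_top_of_le_ne_top ENNReal.one_ne_top
    (min_le_right _ _)
  rw [ENNReal.ofReal_mul hT.le, ENNReal.mul_rpow_of_ne_top (by simp) (by simp)]
  gcongr
  refine (rpow_neg_anti (hcf z) hβ0.le).trans ?_
  rw [ENNReal.mul_rpow_of_ne_top (by simp) hm]
  gcongr
  rcases min_choice (Metric.infEDist z (zeroSet f)) 1 with e | e <;> rw [e]
  · exact le_add_self
  · simp

end Singular

/-! ### The drift inequality and the sublevel sets of the weight. -/

section Transition

variable (f₁ f₂ : C(S1, ℝ))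

theorem continuous_step :
    Continuous fun y : T2 × (ℝ × ℝ) => shear₂ f₂ y.2.2 (shear₁ f₁ y.2.1 y.1) := by
  have hc : Continuous fun t : ℝ => (t : S1) := AddCircle.continuous_mk' _
  simp only [shear₁, shear₂]
  fun_prop

theorem isProbabilityMeasure_timeLaw {T : ℝ} (hT : 0 < T) : IsProbabilityMeasure (timeLaw T) := by
  have : ∀ _ : ℕ, IsProbabilityMeasure (ProbabilityTheory.cond (volume : Measure ℝ) (Icc 0 T)) :=
    fun _ => isProbabilityMeasure_unif hT
  unfold timeLaw
  infer_instance

theorem measurable_chain_one_right (x : Phase f₁ f₂) :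
    Measurable fun τ : ℕ → ℝ => chain f₁ f₂ τ 1 x :=
  (measurable_chain_one f₁ f₂).comp measurable_prodMk_left

theorem isMarkovKernel_transition {T : ℝ} (hT : 0 < T) : IsMarkovKernel (transition f₁ f₂ T) := by
  have := isProbabilityMeasure_timeLaw hT
  exact ⟨fun x => Measure.isProbabilityMeasure_map (measurable_chain_one_right f₁ f₂ x).aemeasurable⟩

/-- One step of the chain averages over two independent uniform times. -/
theorem lintegral_transition {T : ℝ} (hT : 0 < T) (x : Phase f₁ f₂) {g : T2 → ℝ≥0∞} (hg : Measurable g) :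
    ∫⁻ y, g y.1 ∂(transition f₁ f₂ T x) =
      ∫⁻ u, ∫⁻ v, g (shear₂ f₂ v (shear₁ f₁ u x.1)) ∂(unif T) ∂(unif T) := by
  have hu := isProbabilityMeasure_unif hT
  have hm : Measurable fun y : ℝ × ℝ => g (shear₂ f₂ y.2 (shear₁ f₁ y.1 x.1)) :=
    hg.comp ((continuous_step f₁ f₂).measurable.comp measurable_prodMk_left)
  change ∫⁻ y, g y.1 ∂((timeLaw T).map fun τ => chain f₁ f₂ τ 1 x) = _
  have hg' : Measurable fun y : Phase f₁ f₂ => g y.1 := hg.comp measurable_subtype_coe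
  rw [lintegral_map hg' (measurable_chain_one_right f₁ f₂ x)]
  have e : (timeLaw T).map (fun τ : ℕ → ℝ => (τ 0, τ 1)) = (unif T).prod (unif T) := by
    exact Measure.infinitePi_map_eval_prod (P := fun _ : ℕ => unif T) zero_ne_one
  rw [← lintegral_prod _ hm.aemeasurable, ← e, lintegral_map hm (by fun_prop)]
  rfl

/-- The singular part of the Lyapunov function, on the whole torus. -/
def weight (β : ℝ) (x : T2) : ℝ≥0∞ :=
  max (Metric.infEDist x.1 (zeroSet f₂)) (Metric.infEDist x.2 (zeroSet f₁)) ^ (-β)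

theorem continuous_weight (β : ℝ) : Continuous (weight f₁ f₂ β) :=
  ENNReal.continuous_rpow_const.comp
    ((Metric.continuous_infEDist.comp continuous_fst).max
      (Metric.continuous_infEDist.comp continuous_snd))

variable {f₁ f₂}

theorem weight_ne_top {β : ℝ} (hβ : 0 < β) (x : Phase f₁ f₂) : weight f₁ f₂ β x.1 ≠ ∞ := by
  intro h
  rcases ENNReal.rpow_eq_top_iff.1 h with ⟨h0, -⟩ | ⟨-, h0⟩
  · rw [← nonpos_iff_eq_zero, max_le_iff, nonpos_iff_eq_zero, nonpos_iff_eq_zero] at h0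
    refine x.2 ⟨?_, ?_⟩
    · exact (Metric.mem_iff_infEDist_zero_of_closed (isClosed_zeroSet f₁)).2 h0.2
    · exact (Metric.mem_iff_infEDist_zero_of_closed (isClosed_zeroSet f₂)).2 h0.1
  · linarith

/-- The drift inequality, with a contraction factor decaying in `T` and an additive constant
independent of `T`. -/
theorem exists_drift (H1₁ : zeroSet f₁ ∩ zeroSet (circleDeriv f₁) = ∅)
    (H1₂ : zeroSet f₂ ∩ zeroSet (circleDeriv f₂) = ∅) {β : ℝ} (hβ0 : 0 < β) (hβ1 : β < 1) :
    ∃ E K : ℝ≥0∞, E ≠ ∞ ∧ K ≠ ∞ ∧ ∀ T : ℝ, 1 ≤ T → ∀ x : Phase f₁ f₂,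
      ∫⁻ y, weight f₁ f₂ β y.1 ∂(transition f₁ f₂ T x) ≤
        E * ENNReal.ofReal T ^ (-β) * weight f₁ f₂ β x.1 + K := by
  obtain ⟨A₁, hA₁, hA₁'⟩ := exists_lintegral_unif_le hβ0 hβ1 (finite_zeroSet H1₁)
  obtain ⟨A₂, hA₂, hA₂'⟩ := exists_lintegral_unif_le hβ0 hβ1 (finite_zeroSet H1₂)
  obtain ⟨B₂, hB₂, hB₂'⟩ := exists_lintegral_unif_le_infEDist hβ0 hβ1 (finite_zeroSet H1₂)
  obtain ⟨M₁, hM₁, hM₁'⟩ := exists_rpow_neg_le H1₁ hβ0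
  obtain ⟨M₂, hM₂, hM₂'⟩ := exists_rpow_neg_le H1₂ hβ0
  set D := B₂ + A₂ * (1 + M₁)
  have hD : D ≠ ∞ := by simp only [D]; finiteness
  refine ⟨A₁ * M₂ * D, A₁ + A₁ * M₂ * (1 + D), by finiteness, by finiteness, fun T hT x => ?_⟩
  have hT0 : 0 < T := by linarith
  have := isProbabilityMeasure_unif hT0
  rw [lintegral_transition f₁ f₂ hT0 x (continuous_weight f₁ f₂ β).measurable]
  set t := ENNReal.ofReal T ^ (-β)
  have ht : t ≤ 1 := ENNReal.rpow_le_one_of_one_le_of_neg (by simpa using hT) (by linarith)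
  set q := x.1.1
  set p := x.1.2
  set w := weight f₁ f₂ β x.1 with hw
  -- Only the distance in `p` is kept after the vertical shear. Its speed is `f₂` at the new `q`,
  -- and this is the average that produces the factor `T^{-β}`.
  have hinner : ∀ u : ℝ, ∫⁻ v, weight f₁ f₂ β (shear₂ f₂ v (shear₁ f₁ u x.1)) ∂(unif T) ≤
      A₁ * (1 + t * (M₂ * (1 + Metric.infEDist (q + ((u * f₁ p : ℝ) : S1)) (zeroSet f₂) ^ (-β)))) := by
    intro u
    refine (lintegral_mono fun v => rpow_neg_anti (le_max_right _ _) hβ0.le).trans ?_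
    refine (hA₁' T hT0 p (f₂ (q + ((u * f₁ p : ℝ) : S1)))).trans ?_
    gcongr
    exact hM₂' T hT0 _
  have houter : ∫⁻ u, Metric.infEDist (q + ((u * f₁ p : ℝ) : S1)) (zeroSet f₂) ^ (-β) ∂(unif T) ≤
      D * (1 + w) := by
    -- No gain in `T` is needed here. If `q` realizes the maximum, the bound uniform in the speed
    -- applies; if `p` does, `|f₁(p)|` is controlled from below by its distance to the zeros.
    rcases max_choice (Metric.infEDist q (zeroSet f₂)) (Metric.infEDist p (zeroSet f₁)) with e | e
    · have hwe : w = Metric.infEDist q (zeroSet f₂) ^ (-β) := congrArg (· ^ (-β)) e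
      rw [hwe]
      exact (hB₂' T hT0 q (f₁ p)).trans (by gcongr; exact le_self_add)
    · have hwe : w = Metric.infEDist p (zeroSet f₁) ^ (-β) := congrArg (· ^ (-β)) e
      refine (hA₂' T hT0 q (f₁ p)).trans ?_
      calc A₂ * (1 + ENNReal.ofReal (T * |f₁ p|) ^ (-β)) ≤ A₂ * (1 + 1 * (M₁ * (1 + w))) := by
            gcongr
            refine (hM₁' T hT0 p).trans ?_
            rw [hwe]
            gcongr
        _ ≤ A₂ * ((1 + w) + 1 * (M₁ * (1 + w))) := by gcongr; exact le_self_add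
        _ = A₂ * (1 + M₁) * (1 + w) := by ring
        _ ≤ D * (1 + w) := by gcongr; exact le_add_self
  refine (lintegral_mono hinner).trans ?_
  have hmeas : Measurable fun u : ℝ =>
      Metric.infEDist (q + ((u * f₁ p : ℝ) : S1)) (zeroSet f₂) ^ (-β) :=
    (measurable_infEDist_rpow _ β).comp (continuous_arc_map q (f₁ p)).measurable
  have e : ∫⁻ u, A₁ * (1 + t * (M₂ * (1 +
        Metric.infEDist (q + ((u * f₁ p : ℝ) : S1)) (zeroSet f₂) ^ (-β)))) ∂(unif T) =
      A₁ * (1 + t * (M₂ * (1 +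
        ∫⁻ u, Metric.infEDist (q + ((u * f₁ p : ℝ) : S1)) (zeroSet f₂) ^ (-β) ∂(unif T)))) := by
    rw [lintegral_const_mul _ (by fun_prop), lintegral_add_left measurable_const,
      lintegral_const_mul _ (by fun_prop), lintegral_const_mul _ (by fun_prop),
      lintegral_add_left measurable_const]
    simp
  rw [e]
  calc _ ≤ A₁ * (1 + t * (M₂ * (1 + D * (1 + w)))) := by gcongr
    _ = A₁ * M₂ * D * t * w + (A₁ + A₁ * M₂ * (1 + D) * t) := by ring
    _ ≤ A₁ * M₂ * D * t * w + (A₁ + A₁ * M₂ * (1 + D) * 1) := by gcongr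
    _ = _ := by rw [mul_one]

/-- A bounded weight keeps the larger of the two distances away from zero, and simplicity of the
zeros passes this to the corresponding shear. No time `T` enters, so `η` can be fixed before `T`. -/
theorem exists_lower_bound (H1₁ : zeroSet f₁ ∩ zeroSet (circleDeriv f₁) = ∅)
    (H1₂ : zeroSet f₂ ∩ zeroSet (circleDeriv f₂) = ∅) {β : ℝ} (hβ0 : 0 < β) {R : ℝ≥0∞}
    (hR : R ≠ ∞) :
    ∃ η : ℝ, 0 < η ∧ ∀ x : T2, weight f₁ f₂ β x ≤ R → η ≤ |f₁ x.2| ∨ η ≤ |f₂ x.1| := by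
  obtain ⟨M₁, hM₁, hM₁'⟩ := exists_rpow_neg_le H1₁ hβ0
  obtain ⟨M₂, hM₂, hM₂'⟩ := exists_rpow_neg_le H1₂ hβ0
  set B := (M₁ + M₂) * (1 + R)
  have hB : B ≠ ∞ := by simp only [B]; finiteness
  have hBpos : 0 < B ^ (-β⁻¹) := by
    rw [ENNReal.rpow_neg]
    exact ENNReal.inv_pos.2 (ENNReal.rpow_ne_top_of_nonneg (inv_nonneg.2 hβ0.le) hB)
  obtain ⟨η, hη0, hη⟩ := ENNReal.lt_iff_exists_nnreal_btwn.1 hBpos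
  have hinv : ∀ y : ℝ, 0 ≤ y → ENNReal.ofReal y ^ (-β) ≤ B → (η : ℝ) ≤ y := fun y hy h => by
    have h1 := rpow_neg_anti h (inv_nonneg.2 hβ0.le)
    rw [← ENNReal.rpow_mul, neg_mul_neg, mul_inv_cancel₀ hβ0.ne', ENNReal.rpow_one] at h1
    have h2 := hη.le.trans h1
    rwa [ENNReal.le_ofReal_iff_toReal_le (by simp) hy] at h2
  refine ⟨η, by simpa using hη0, fun x hx => ?_⟩
  rcases max_choice (Metric.infEDist x.1 (zeroSet f₂)) (Metric.infEDist x.2 (zeroSet f₁))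
    with e | e
  · have hwe : weight f₁ f₂ β x = Metric.infEDist x.1 (zeroSet f₂) ^ (-β) := congrArg (· ^ (-β)) e
    right
    refine hinv _ (abs_nonneg _) ?_
    have := hM₂' 1 one_pos x.1
    simp only [one_mul, ENNReal.ofReal_one, ENNReal.one_rpow] at this
    refine this.trans ?_
    rw [← hwe]
    exact mul_le_mul' le_add_self (by gcongr)
  · have hwe : weight f₁ f₂ β x = Metric.infEDist x.2 (zeroSet f₁) ^ (-β) := congrArg (· ^ (-β)) e
    left
    refine hinv _ (abs_nonneg _) ?_
    have := hM₁' 1 one_pos x.2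
    simp only [one_mul, ENNReal.ofReal_one, ENNReal.one_rpow] at this
    refine this.trans ?_
    rw [← hwe]
    exact mul_le_mul' le_self_add (by gcongr)

end Transition

/-! ### Stationarity of Lebesgue measure and integrability of the weight. -/

section Lebesgue

variable (f₁ f₂ : C(S1, ℝ))

theorem measurePreserving_shear₂ (τ : ℝ) : MeasurePreserving (shear₂ f₂ τ) := by
  have hc : Continuous fun t : ℝ => (t : S1) := AddCircle.continuous_mk' _
  have hm : Measurable (Function.uncurry fun (q p : S1) => p + ((τ * f₂ q : ℝ) : S1)) := by
    refine Continuous.measurable ?_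
    simp only [Function.uncurry_def]
    fun_prop
  exact (MeasurePreserving.id (volume : Measure S1)).skew_product hm
    (ae_of_all _ fun q => map_add_right_eq_self volume _)

theorem measurePreserving_shear₁ (τ : ℝ) : MeasurePreserving (shear₁ f₁ τ) :=
  (Measure.measurePreserving_swap (μ := (volume : Measure S1)) (ν := (volume : Measure S1))).comp
    ((measurePreserving_shear₂ f₁ τ).comp
      (Measure.measurePreserving_swap (μ := (volume : Measure S1)) (ν := (volume : Measure S1))))

theorem measurableSet_phase : MeasurableSet ((fixedSet f₁ f₂)ᶜ : Set T2) := by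
  refine IsOpen.measurableSet (isOpen_compl_iff.2 ?_)
  exact (isClosed_eq (by fun_prop) continuous_const).inter
    (isClosed_eq (by fun_prop) continuous_const)

/-- For each fixed pair of times the step preserves Lebesgue measure on the torus; Tonelli's theorem
transfers this to the average over times. -/
theorem isStationary_lebesgue {T : ℝ} (hT : 0 < T) (h0 : (volume : Measure T2) (fixedSet f₁ f₂)ᶜ ≠ 0) :
    IsStationary (transition f₁ f₂ T) (lebesgue f₁ f₂) := by
  have hO := measurableSet_phase f₁ f₂
  have hu := isProbabilityMeasure_unif hT
  set O : Set T2 := (fixedSet f₁ f₂)ᶜ with hOdef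
  refine ⟨⟨?_⟩, ?_⟩
  · rw [lebesgue, Measure.smul_apply, smul_eq_mul, comap_subtype_coe_apply hO]
    simp only [image_univ, Subtype.range_coe_subtype, ofPred_mem_eq]
    exact ENNReal.inv_mul_cancel h0 (measure_ne_top _ _)
  · rw [Kernel.Invariant, lebesgue, Measure.bind_smul]
    congr 1
    ext A hA
    set B : Set T2 := Subtype.val '' A
    have hB : MeasurableSet B := hO.subtype_image hA
    rw [Measure.bind_apply hA (Kernel.aemeasurable _), comap_subtype_coe_apply hO]
    set g : T2 → ℝ≥0∞ := B.indicator 1 with hg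
    have hgm : Measurable g := measurable_one.indicator hB
    have e1 : ∀ x : Phase f₁ f₂, transition f₁ f₂ T x A =
        ∫⁻ u, ∫⁻ v, g (shear₂ f₂ v (shear₁ f₁ u x.1)) ∂(unif T) ∂(unif T) := fun x => by
      rw [← lintegral_transition f₁ f₂ hT x hgm, ← lintegral_indicator_one hA]
      refine lintegral_congr fun y => ?_
      by_cases hy : y ∈ A
      · rw [hg, indicator_of_mem hy, indicator_of_mem (mem_image_of_mem _ hy)]; rfl
      · simp [hg, B, hy]
    set h : T2 → ℝ≥0∞ := fun x =>
      ∫⁻ u, ∫⁻ v, g (shear₂ f₂ v (shear₁ f₁ u x)) ∂(unif T) ∂(unif T)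
    have hstep : Measurable fun y : T2 × (ℝ × ℝ) => g (shear₂ f₂ y.2.2 (shear₁ f₁ y.2.1 y.1)) :=
      hgm.comp (continuous_step f₁ f₂).measurable
    have hh : h = fun x => ∫⁻ y : ℝ × ℝ, g (shear₂ f₂ y.2 (shear₁ f₁ y.1 x))
        ∂((unif T).prod (unif T)) := by
      funext x
      exact (lintegral_prod (fun y : ℝ × ℝ => g (shear₂ f₂ y.2 (shear₁ f₁ y.1 x)))
        (hstep.comp measurable_prodMk_left).aemeasurable).symm
    -- Points of `F` are fixed by both shears and lie outside `B`, so the integral over `𝒪` extends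
    -- to the whole torus.
    have hsupp : ∀ x, x ∉ O → h x = 0 := fun x hx => by
      have hx' : f₁ x.2 = 0 ∧ f₂ x.1 = 0 := by simpa [hOdef, fixedSet] using hx
      have hxB : x ∉ B := fun hxB => hx (Subtype.coe_image_subset _ _ hxB)
      have : ∀ u v : ℝ, shear₂ f₂ v (shear₁ f₁ u x) = x := fun u v => by
        simp [shear₁, shear₂, hx'.1, hx'.2]
      simp [h, this, hg, hxB]
    calc ∫⁻ x, transition f₁ f₂ T x A ∂((volume : Measure T2).comap Subtype.val)
        = ∫⁻ x : O, h x.1 ∂((volume : Measure T2).comap Subtype.val) := lintegral_congr e1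
      _ = ∫⁻ x in O, h x := lintegral_subtype_comap hO h
      _ = ∫⁻ x, h x := by
          refine setLIntegral_eq_of_support_subset ?_
          exact fun x hx => by_contra fun hxO => hx (hsupp x hxO)
      _ = ∫⁻ y : ℝ × ℝ, (∫⁻ x, g (shear₂ f₂ y.2 (shear₁ f₁ y.1 x))) ∂((unif T).prod (unif T)) := by
          rw [hh]
          exact lintegral_lintegral_swap hstep.aemeasurable
      _ = ∫⁻ _ : ℝ × ℝ, (volume : Measure T2) B ∂((unif T).prod (unif T)) := by
          refine lintegral_congr fun y => ?_
          exact (((measurePreserving_shear₂ f₂ y.2).comp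
            (measurePreserving_shear₁ f₁ y.1)).lintegral_comp hgm).trans (lintegral_indicator_one hB)
      _ = (volume : Measure T2) B := by simp

/-- The distance in `q` alone suffices: its power `-β` is integrable on the circle because the zeros
are finitely many and `β < 1`. -/
theorem lintegral_weight_lt_top {f₁ f₂ : C(S1, ℝ)}
    (H1₂ : zeroSet f₂ ∩ zeroSet (circleDeriv f₂) = ∅) {β : ℝ} (hβ0 : 0 < β) (hβ1 : β < 1) :
    ∫⁻ x, weight f₁ f₂ β x < ∞ := by
  refine (lintegral_mono fun x => rpow_neg_anti (le_max_left _ _) hβ0.le).trans_lt ?_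
  have hm : Measurable fun x : T2 => Metric.infEDist x.1 (zeroSet f₂) ^ (-β) :=
    (measurable_infEDist_rpow (zeroSet f₂) β).comp measurable_fst
  rw [Measure.volume_eq_prod, lintegral_prod _ hm.aemeasurable]
  simp only [lintegral_const]
  rw [lintegral_mul_const _ (measurable_infEDist_rpow _ β)]
  exact ENNReal.mul_lt_top (lintegral_infEDist_rpow_neg_lt_top hβ0 hβ1 (finite_zeroSet H1₂))
    (measure_lt_top _ _)

end Lebesgue

/-! ### Minorization of the two-step kernel. -/

section Minorization

variable (f₁ f₂ : C(S1, ℝ))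

/-- The points of the circle at which the shear `f` winds at least once in time `T`. -/
def winding (f : C(S1, ℝ)) (T : ℝ) : Set S1 := {z | 2 * Real.pi ≤ T * |f z|}

theorem measurableSet_winding (f : C(S1, ℝ)) (T : ℝ) : MeasurableSet (winding f T) :=
  (isClosed_le continuous_const (by fun_prop)).measurableSet

theorem volume_winding_pos {f : C(S1, ℝ)} {T : ℝ} {z : S1} (h : 2 * Real.pi < T * |f z|) :
    0 < volume (winding f T) := by
  have ho : IsOpen {z : S1 | 2 * Real.pi < T * |f z|} :=
    isOpen_lt continuous_const (by fun_prop)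
  refine (ho.measure_pos volume ⟨z, h⟩).trans_le (measure_mono fun w hw => ?_)
  have hw : 2 * Real.pi < T * |f w| := hw
  exact hw.le

/-- The lower bound for the density of the law on an arc winding around the circle. -/
def arcDensity : ℝ≥0∞ := ENNReal.ofReal (1 / (4 * Real.pi))

theorem arcDensity_pos : 0 < arcDensity := by
  have := Real.pi_pos
  exact ENNReal.ofReal_pos.2 (by positivity)

theorem arcDensity_ne_top : arcDensity ≠ ∞ := ENNReal.ofReal_ne_top

/-- Averaging along a winding arc dominates averaging over the circle. -/
theorem lintegral_le_lintegral_unif {T : ℝ} (hT : 0 < T) (s : S1) {a : ℝ}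
    (ha : 2 * Real.pi ≤ T * |a|) {h : S1 → ℝ≥0∞} (hh : Measurable h) :
    arcDensity * ∫⁻ w, h w ≤ ∫⁻ v, h (s + ((v * a : ℝ) : S1)) ∂(unif T) := by
  have e : ∫⁻ v, h (s + ((v * a : ℝ) : S1)) ∂(unif T) = ∫⁻ w, h w ∂(arc T s a) := by
    rw [arc, lintegral_map hh (continuous_arc_map s a).measurable]
  rw [e, ← smul_eq_mul, arcDensity, ← lintegral_smul_measure]
  exact lintegral_mono' (le_arc hT s ha) le_rfl

/-- From a point whose horizontal orbit winds, one step dominates a multiple of Lebesgue measure. -/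
theorem le_lintegral_transition {T : ℝ} (hT : 0 < T) (x : Phase f₁ f₂)
    (hx : x.1.2 ∈ winding f₁ T) {g : T2 → ℝ≥0∞} (hg : Measurable g) :
    arcDensity * (arcDensity * ∫⁻ y in winding f₂ T ×ˢ univ, g y) ≤
      ∫⁻ y, g y.1 ∂(transition f₁ f₂ T x) := by
  rw [lintegral_transition f₁ f₂ hT x hg]
  have hm : Measurable fun q : S1 => ∫⁻ w, g (q, w) := hg.lintegral_prod_right'
  -- `Ψ` is the mass guaranteed by the vertical shear where it winds; the winding horizontal shear
  -- then averages `Ψ` over the circle.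
  set Ψ : S1 → ℝ≥0∞ := (winding f₂ T).indicator fun q => arcDensity * ∫⁻ w, g (q, w)
  have hΨ : Measurable Ψ := (hm.const_mul _).indicator (measurableSet_winding f₂ T)
  have h1 : ∀ u : ℝ, Ψ (x.1.1 + ((u * f₁ x.1.2 : ℝ) : S1)) ≤
      ∫⁻ v, g (shear₂ f₂ v (shear₁ f₁ u x.1)) ∂(unif T) := fun u => by
    by_cases hq : x.1.1 + ((u * f₁ x.1.2 : ℝ) : S1) ∈ winding f₂ T
    · simp only [Ψ, indicator_of_mem hq]
      exact lintegral_le_lintegral_unif hT x.1.2 hq (hg.comp measurable_prodMk_left)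
    · simp only [Ψ, indicator_of_notMem hq]
      exact zero_le
  refine le_trans ?_ (lintegral_mono h1)
  refine le_trans ?_ (lintegral_le_lintegral_unif hT x.1.1 hx hΨ)
  have e : arcDensity * ∫⁻ y in winding f₂ T ×ˢ univ, g y = ∫⁻ q, Ψ q := by
    rw [lintegral_indicator (measurableSet_winding f₂ T), lintegral_const_mul _ hm,
      Measure.volume_eq_prod, ← Measure.prod_restrict, Measure.restrict_univ,
      lintegral_prod _ hg.aemeasurable]
  rw [e]

/-- From the region where one of the shears is bounded below, the chain reaches with uniformly
positive probability a point whose horizontal orbit winds. -/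
theorem exists_le_lintegral_transition {T η : ℝ} (hT : 0 < T) (hη : 0 < η)
    (hTη : 4 * Real.pi ≤ T * η) {z₁ z₂ : S1} (hz₁ : 2 * Real.pi < T * |f₁ z₁|)
    (hz₂ : 2 * Real.pi < T * |f₂ z₂|) :
    ∃ ε : ℝ≥0∞, 0 < ε ∧ ε ≠ ∞ ∧ ∀ x : Phase f₁ f₂, η ≤ |f₁ x.1.2| ∨ η ≤ |f₂ x.1.1| →
      ε ≤ transition f₁ f₂ T x {y | y.1.2 ∈ winding f₁ T} := by
  have hpi := Real.pi_pos
  have hW₁ := measurableSet_winding f₁ T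
  have hv₁ := volume_winding_pos hz₁
  have hv₂ := volume_winding_pos hz₂
  have hS : MeasurableSet {y : T2 | y.2 ∈ winding f₁ T} := measurable_snd hW₁
  set g : T2 → ℝ≥0∞ := {y : T2 | y.2 ∈ winding f₁ T}.indicator 1 with hg
  have hgm : Measurable g := measurable_one.indicator hS
  have e : ∀ x : Phase f₁ f₂, transition f₁ f₂ T x {y | y.1.2 ∈ winding f₁ T} =
      ∫⁻ y, g y.1 ∂(transition f₁ f₂ T x) := fun x => by
    have hS' : MeasurableSet {y : Phase f₁ f₂ | y.1.2 ∈ winding f₁ T} :=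
      measurable_subtype_coe hS
    rw [← lintegral_indicator_one hS']
    rfl
  obtain ⟨δ, hδ, hδ'⟩ := Metric.uniformContinuous_iff.1
    (CompactSpace.uniformContinuous_of_continuous f₂.continuous) (η / 2) (half_pos hη)
  -- If the horizontal shear does not wind, `T|f₁(p)| < 2π`, so times `u ≤ θT` displace `q` by at
  -- most `δ/2`. Then `|f₂| ≥ η/2` persists, and `Tη ≥ 4π` makes the vertical shear wind.
  set θ := min 1 (δ / (4 * Real.pi))
  have hθ : 0 < θ := by positivity
  set ε₁ := arcDensity * (arcDensity * (volume (winding f₂ T) * volume (winding f₁ T)))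
  set ε₂ := ENNReal.ofReal θ * (arcDensity * volume (winding f₁ T))
  have hε₁ : 0 < ε₁ := ENNReal.mul_pos arcDensity_pos.ne' (ENNReal.mul_pos arcDensity_pos.ne'
    (ENNReal.mul_pos hv₂.ne' hv₁.ne').ne').ne'
  have hε₂ : 0 < ε₂ := ENNReal.mul_pos (ENNReal.ofReal_pos.2 hθ).ne'
    (ENNReal.mul_pos arcDensity_pos.ne' hv₁.ne').ne'
  refine ⟨min ε₁ ε₂, lt_min hε₁ hε₂, ne_top_of_le_ne_top ?_ (min_le_right _ _), fun x hx => ?_⟩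
  · exact ENNReal.mul_ne_top ENNReal.ofReal_ne_top
      (ENNReal.mul_ne_top arcDensity_ne_top (measure_ne_top _ _))
  rw [e]
  by_cases hxW : x.1.2 ∈ winding f₁ T
  · refine (min_le_left _ _).trans (le_trans (le_of_eq ?_)
      (le_lintegral_transition f₁ f₂ hT x hxW hgm))
    have hset : {y : T2 | y.2 ∈ winding f₁ T} ∩ winding f₂ T ×ˢ univ =
        winding f₂ T ×ˢ winding f₁ T := by
      ext y
      simp [and_comm]
    rw [lintegral_indicator_one hS, Measure.restrict_apply hS, hset, Measure.volume_eq_prod,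
      Measure.prod_prod]
  · have hx1 : T * |f₁ x.1.2| < 2 * Real.pi := not_le.1 hxW
    have hx2 : η ≤ |f₂ x.1.1| := by
      refine hx.resolve_left fun h => ?_
      have := mul_le_mul_of_nonneg_left h hT.le
      linarith
    refine (min_le_right _ _).trans ?_
    rw [lintegral_transition f₁ f₂ hT x hgm]
    have h1 : ∀ u ∈ Icc 0 (θ * T), arcDensity * volume (winding f₁ T) ≤
        ∫⁻ v, g (shear₂ f₂ v (shear₁ f₁ u x.1)) ∂(unif T) := fun u hu => by
      have hdist : dist (x.1.1 + ((u * f₁ x.1.2 : ℝ) : S1)) x.1.1 < δ := by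
        rw [dist_eq_norm, add_sub_cancel_left]
        refine lt_of_le_of_lt QuotientAddGroup.norm_mk_le_norm ?_
        rw [Real.norm_eq_abs, abs_mul, abs_of_nonneg hu.1]
        calc u * |f₁ x.1.2| ≤ θ * T * |f₁ x.1.2| := by gcongr; exact hu.2
          _ = θ * (T * |f₁ x.1.2|) := by ring
          _ ≤ δ / (4 * Real.pi) * (2 * Real.pi) := by
              gcongr
              exact min_le_right _ _
          _ = δ / 2 := by field_simp; norm_num
          _ < δ := half_lt_self hδ
      have hf := hδ' hdist
      rw [Real.dist_eq] at hf
      have hf' : η / 2 ≤ |f₂ (x.1.1 + ((u * f₁ x.1.2 : ℝ) : S1))| := by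
        have := abs_sub_abs_le_abs_sub (f₂ x.1.1) (f₂ (x.1.1 + ((u * f₁ x.1.2 : ℝ) : S1)))
        rw [abs_sub_comm] at this
        linarith
      have hwind : 2 * Real.pi ≤ T * |f₂ (x.1.1 + ((u * f₁ x.1.2 : ℝ) : S1))| := by
        have := mul_le_mul_of_nonneg_left hf' hT.le
        linarith
      rw [← lintegral_indicator_one hW₁]
      exact lintegral_le_lintegral_unif hT x.1.2 hwind (measurable_one.indicator hW₁)
    calc ε₂ = ∫⁻ u, (Icc 0 (θ * T)).indicator
          (fun _ => arcDensity * volume (winding f₁ T)) u ∂(unif T) := by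
          rw [lintegral_indicator_const measurableSet_Icc, unif_apply hT,
            inter_eq_self_of_subset_right (Icc_subset_Icc_right
              (mul_le_of_le_one_left hT.le (min_le_left _ _))), Real.volume_Icc,
            ← ENNReal.ofReal_mul (by positivity), sub_zero, mul_comm T⁻¹, mul_assoc θ,
            mul_inv_cancel₀ hT.ne', mul_one, mul_comm]
      _ ≤ _ := lintegral_mono fun u => by
          by_cases hu : u ∈ Icc 0 (θ * T)
          · rw [indicator_of_mem hu]; exact h1 u hu
          · rw [indicator_of_notMem hu]; exact zero_le

/-- Two steps of the chain are minorized by a fixed measure, uniformly on the region where one of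
the shears is bounded below. -/
theorem exists_minorization {T η : ℝ} (hT : 0 < T) (hη : 0 < η)
    (hTη : 4 * Real.pi ≤ T * η) {z₁ z₂ : S1} (hz₁ : 2 * Real.pi < T * |f₁ z₁|)
    (hz₂ : 2 * Real.pi < T * |f₂ z₂|) :
    ∃ ν : Measure (Phase f₁ f₂), IsFiniteMeasure ν ∧ ν ≠ 0 ∧
      ∀ x : Phase f₁ f₂, η ≤ |f₁ x.1.2| ∨ η ≤ |f₂ x.1.1| → ν ≤ (transition f₁ f₂ T ^ 2) x := by
  obtain ⟨ε, hε0, hεtop, hε⟩ := exists_le_lintegral_transition f₁ f₂ hT hη hTη hz₁ hz₂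
  have hO := measurableSet_phase f₁ f₂
  have hW₂ := measurableSet_winding f₂ T
  have hW₁ := measurableSet_winding f₁ T
  set W : Set T2 := winding f₂ T ×ˢ univ
  have hW : MeasurableSet W := hW₂.prod MeasurableSet.univ
  have hpi := Real.pi_pos
  have hc := arcDensity_pos
  set κ := ε * (arcDensity * arcDensity)
  have hκ0 : κ ≠ 0 := mul_ne_zero hε0.ne' (mul_ne_zero hc.ne' hc.ne')
  have hκtop : κ ≠ ∞ := ENNReal.mul_ne_top hεtop
    (ENNReal.mul_ne_top arcDensity_ne_top arcDensity_ne_top)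
  set ν₀ : Measure (Phase f₁ f₂) := ((volume : Measure T2).restrict W).comap Subtype.val with hν₀
  have happ : ∀ A : Set (Phase f₁ f₂), ν₀ A = (volume : Measure T2).restrict W (Subtype.val '' A) :=
    fun A => comap_subtype_coe_apply hO _ A
  refine ⟨κ • ν₀, ⟨?_⟩, ?_, fun x hx => Measure.le_iff.2 fun A hA => ?_⟩
  · rw [Measure.smul_apply, smul_eq_mul, happ]
    exact ENNReal.mul_lt_top hκtop.lt_top (measure_lt_top _ _)
  · intro h0
    have h1 : (κ • ν₀) univ = 0 := by rw [h0]; simp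
    rw [Measure.smul_apply, smul_eq_mul, happ] at h1
    have h2 := (mul_eq_zero.1 h1).resolve_left hκ0
    simp only [image_univ, Subtype.range_coe_subtype, ofPred_mem_eq] at h2
    rw [Measure.restrict_apply hO] at h2
    -- A winding vertical shear has `f₂ ≠ 0`, so `W` misses `F` and restricting to `𝒪` loses no
    -- mass.
    have h3 : W ⊆ (fixedSet f₁ f₂)ᶜ ∩ W := fun y hy => by
      refine ⟨fun hF => ?_, hy⟩
      have h4 : 2 * Real.pi ≤ T * |f₂ y.1| := hy.1
      rw [hF.2] at h4
      simp at h4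
      linarith
    have h5 : (volume : Measure T2) W = 0 := measure_mono_null h3 h2
    rw [Measure.volume_eq_prod, Measure.prod_prod, AddCircle.measure_univ] at h5
    rcases mul_eq_zero.1 h5 with h6 | h6
    · exact (volume_winding_pos hz₂).ne' h6
    · exact (ENNReal.ofReal_pos.2 Real.two_pi_pos).ne' h6
  · set B : Set T2 := Subtype.val '' A
    have hB : MeasurableSet B := hO.subtype_image hA
    have hS : MeasurableSet {y : Phase f₁ f₂ | y.1.2 ∈ winding f₁ T} :=
      (measurable_snd.comp measurable_subtype_coe) hW₁
    have h1 : ∀ y : Phase f₁ f₂, y.1.2 ∈ winding f₁ T →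
        arcDensity * (arcDensity * ν₀ A) ≤ transition f₁ f₂ T y A := fun y hy => by
      have h2 := le_lintegral_transition f₁ f₂ hT y hy (g := B.indicator 1)
        (measurable_one.indicator hB)
      rw [lintegral_indicator_one hB] at h2
      rw [happ, ← lintegral_indicator_one hA]
      refine h2.trans (le_of_eq (lintegral_congr fun z => ?_))
      by_cases hz : z ∈ A
      · rw [indicator_of_mem hz, indicator_of_mem (mem_image_of_mem _ hz)]; rfl
      · rw [indicator_of_notMem hz, indicator_of_notMem (Subtype.val_injective.mem_set_image.not.2 hz)]
    have e2 : (transition f₁ f₂ T ^ 2) x A =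
        ∫⁻ y, transition f₁ f₂ T y A ∂(transition f₁ f₂ T x) := by
      simpa using Kernel.pow_succ_apply_eq_lintegral (transition f₁ f₂ T) 1 x hA
    rw [e2, Measure.smul_apply, smul_eq_mul]
    calc κ * ν₀ A = arcDensity * (arcDensity * ν₀ A) * ε := by simp only [κ]; ring
      _ ≤ arcDensity * (arcDensity * ν₀ A) *
          transition f₁ f₂ T x {y | y.1.2 ∈ winding f₁ T} := by gcongr; exact hε x hx
      _ = ∫⁻ y, {y : Phase f₁ f₂ | y.1.2 ∈ winding f₁ T}.indicator
          (fun _ => arcDensity * (arcDensity * ν₀ A)) y ∂(transition f₁ f₂ T x) :=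
          (lintegral_indicator_const hS _).symm
      _ ≤ _ := lintegral_mono fun y => by
          by_cases hy : y.1.2 ∈ winding f₁ T
          · rw [indicator_of_mem (by exact hy)]; exact h1 y hy
          · rw [indicator_of_notMem (by exact hy)]; exact zero_le

end Minorization

/-! ### Choice of constants and conclusion. -/

section Main

variable {f₁ f₂ : C(S1, ℝ)}

theorem lyapunov_eq (β b : ℝ) (x : Phase f₁ f₂) :
    lyapunov f₁ f₂ β b x = (weight f₁ f₂ β x.1).toReal + b := rfl

/-- `ENNReal.toReal` is continuous at finite values, and the weight is finite off `F`. -/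
theorem continuous_lyapunov {β : ℝ} (hβ : 0 < β) (b : ℝ) : Continuous (lyapunov f₁ f₂ β b) := by
  have h : Continuous fun x : Phase f₁ f₂ => (weight f₁ f₂ β x.1).toReal :=
    continuous_iff_continuousAt.2 fun x => (ENNReal.tendsto_toReal (weight_ne_top hβ x)).comp
      ((continuous_weight f₁ f₂ β).comp continuous_subtype_val).continuousAt
  exact h.add continuous_const

theorem integrable_lyapunov {β b : ℝ} {μ : Measure (Phase f₁ f₂)} [IsFiniteMeasure μ]
    (h : ∫⁻ x, weight f₁ f₂ β x.1 ∂μ ≠ ∞) : Integrable (lyapunov f₁ f₂ β b) μ :=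
  (integrable_toReal_of_lintegral_ne_top
    ((continuous_weight f₁ f₂ β).measurable.comp measurable_subtype_coe).aemeasurable h).add
    (integrable_const b)

theorem integral_lyapunov {β b : ℝ} (hβ : 0 < β) {μ : Measure (Phase f₁ f₂)}
    [IsProbabilityMeasure μ] (h : ∫⁻ x, weight f₁ f₂ β x.1 ∂μ ≠ ∞) :
    ∫ x, lyapunov f₁ f₂ β b x ∂μ = (∫⁻ x, weight f₁ f₂ β x.1 ∂μ).toReal + b := by
  have hm : AEMeasurable (fun x : Phase f₁ f₂ => weight f₁ f₂ β x.1) μ :=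
    ((continuous_weight f₁ f₂ β).measurable.comp measurable_subtype_coe).aemeasurable
  simp only [lyapunov_eq]
  rw [integral_add (integrable_toReal_of_lintegral_ne_top hm h) (integrable_const b),
    integral_toReal hm (ae_of_all _ fun x => (weight_ne_top hβ x).lt_top)]
  simp

theorem integrable_lyapunov_lebesgue (H1₂ : zeroSet f₂ ∩ zeroSet (circleDeriv f₂) = ∅) {β b : ℝ}
    (hβ0 : 0 < β) (hβ1 : β < 1) (h0 : (volume : Measure T2) (fixedSet f₁ f₂)ᶜ ≠ 0)
    [IsFiniteMeasure (lebesgue f₁ f₂)] :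
    Integrable (lyapunov f₁ f₂ β b) (lebesgue f₁ f₂) := by
  refine integrable_lyapunov ?_
  rw [lebesgue, lintegral_smul_measure, smul_eq_mul]
  refine ENNReal.mul_ne_top (ENNReal.inv_ne_top.2 h0) (ne_top_of_le_ne_top
    (lintegral_weight_lt_top (f₁ := f₁) H1₂ hβ0 hβ1).ne ?_)
  exact (lintegral_subtype_comap (measurableSet_phase f₁ f₂) (weight f₁ f₂ β)).trans_le
    (setLIntegral_le_lintegral _ _)

/-- Ergodicity for large `T`, for any exponent `β < 1`. -/
theorem exists_forall_ergodic (H1₁ : zeroSet f₁ ∩ zeroSet (circleDeriv f₁) = ∅)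
    (H1₂ : zeroSet f₂ ∩ zeroSet (circleDeriv f₂) = ∅) {z₁ z₂ : S1} (hz₁ : f₁ z₁ ≠ 0)
    (hz₂ : f₂ z₂ ≠ 0) {β : ℝ} (hβ0 : 0 < β) (hβ1 : β < 1) :
    ∃ T₀ : ℝ, 0 < T₀ ∧ ∀ T : ℝ, T₀ ≤ T →
      (∀ μ : Measure (Phase f₁ f₂),
        IsStationary (transition f₁ f₂ T) μ ↔ μ = lebesgue f₁ f₂) ∧
      UniformlyGeometricallyErgodic (transition f₁ f₂ T) (lyapunov f₁ f₂ β 1) := by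
  obtain ⟨E, K, hE, hK, hdrift⟩ := exists_drift H1₁ H1₂ hβ0 hβ1
  -- With drift factor `1/2` and constant `K + 1`, Harris' theorem asks for `2(K + 1) < R/4`. The
  -- summand `1` in `K + 1` absorbs `b = 1` and keeps the constant positive.
  set R : ℝ := 8 * (K.toReal + 1) + 1
  obtain ⟨η, hη, hlow⟩ := exists_lower_bound H1₁ H1₂ hβ0 (R := ENNReal.ofReal R) (by simp)
  have h0 : (volume : Measure T2) (fixedSet f₁ f₂)ᶜ ≠ 0 := by
    have ho : IsOpen (fixedSet f₁ f₂)ᶜ := isOpen_compl_iff.2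
      ((isClosed_eq (by fun_prop) continuous_const).inter
        (isClosed_eq (by fun_prop) continuous_const))
    exact (ho.measure_pos volume ⟨(z₂, 0), fun h => hz₂ h.2⟩).ne'
  have hlim : ∀ᶠ T : ℝ in Filter.atTop, E.toReal * T ^ (-β) < 1 / 2 := by
    have := (tendsto_rpow_neg_atTop hβ0).const_mul E.toReal
    rw [mul_zero] at this
    exact this.eventually_lt_const (by norm_num)
  have hev : ∀ᶠ T : ℝ in Filter.atTop, 1 ≤ T ∧ E.toReal * T ^ (-β) < 1 / 2 ∧
      4 * Real.pi ≤ T * η ∧ 2 * Real.pi < T * |f₁ z₁| ∧ 2 * Real.pi < T * |f₂ z₂| := by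
    refine (Filter.eventually_ge_atTop 1).and (hlim.and (Filter.Eventually.and ?_
      (Filter.Eventually.and ?_ ?_)))
    · exact (Filter.tendsto_id.atTop_mul_const hη).eventually_ge_atTop _
    · exact (Filter.tendsto_id.atTop_mul_const (abs_pos.2 hz₁)).eventually_gt_atTop _
    · exact (Filter.tendsto_id.atTop_mul_const (abs_pos.2 hz₂)).eventually_gt_atTop _
  obtain ⟨T₀, hT₀⟩ := Filter.eventually_atTop.1 hev
  refine ⟨max T₀ 1, by positivity, fun T hT => ?_⟩
  obtain ⟨h1T, hρ, hTη, hT1, hT2⟩ := hT₀ T ((le_max_left _ _).trans hT)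
  have hTpos : 0 < T := by linarith
  have := isMarkovKernel_transition f₁ f₂ hTpos
  have hstat := isStationary_lebesgue f₁ f₂ hTpos h0
  have := hstat.1
  obtain ⟨ν, hνfin, hν0, hν⟩ := exists_minorization f₁ f₂ hTpos hη hTη hT1 hT2
  have hdrift' : ∀ x : Phase f₁ f₂, ∫⁻ y, weight f₁ f₂ β y.1 ∂(transition f₁ f₂ T x) ≤
      ENNReal.ofReal (1 / 2) * weight f₁ f₂ β x.1 + K := fun x => by
    refine (hdrift T h1T x).trans ?_
    gcongr
    rw [ENNReal.ofReal_rpow_of_pos hTpos, ← ENNReal.ofReal_toReal hE,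
      ← ENNReal.ofReal_mul ENNReal.toReal_nonneg]
    exact ENNReal.ofReal_le_ofReal hρ.le
  have hfin : ∀ x : Phase f₁ f₂, ENNReal.ofReal (1 / 2) * weight f₁ f₂ β x.1 + K ≠ ∞ := fun x =>
    ENNReal.add_ne_top.2 ⟨ENNReal.mul_ne_top ENNReal.ofReal_ne_top (weight_ne_top hβ0 x), hK⟩
  have hne : ∀ x : Phase f₁ f₂, ∫⁻ y, weight f₁ f₂ β y.1 ∂(transition f₁ f₂ T x) ≠ ∞ := fun x =>
    ne_top_of_le_ne_top (hfin x) (hdrift' x)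
  have hK0 : 0 ≤ K.toReal := ENNReal.toReal_nonneg
  obtain ⟨huniq, herg⟩ := uniformlyGeometricallyErgodic_of_drift_of_minorization
    (P := transition f₁ f₂ T) (V := lyapunov f₁ f₂ β 1) (γ := 1 / 2) (K := K.toReal + 1) (R := R)
    (continuous_lyapunov hβ0 1).measurable
    (fun x => by rw [lyapunov_eq]; linarith [ENNReal.toReal_nonneg (a := weight f₁ f₂ β x.1)])
    (by norm_num) (by norm_num) (by linarith) (fun x => integrable_lyapunov (hne x))
    (fun x => by
      rw [integral_lyapunov hβ0 (hne x), lyapunov_eq]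
      have h := ENNReal.toReal_mono (hfin x) (hdrift' x)
      rw [ENNReal.toReal_add (ENNReal.mul_ne_top ENNReal.ofReal_ne_top (weight_ne_top hβ0 x)) hK,
        ENNReal.toReal_mul, ENNReal.toReal_ofReal (by norm_num)] at h
      linarith)
    (by simp only [R]; linarith) hν0
    (fun x hx => hν x (hlow x.1 (by
      rw [lyapunov_eq] at hx
      rw [ENNReal.le_ofReal_iff_toReal_le (weight_ne_top hβ0 x) (by simp only [R]; positivity)]
      linarith)))
    hstat (integrable_lyapunov_lebesgue H1₂ hβ0 hβ1 h0)
  exact ⟨fun μ => ⟨huniq μ, fun h => h ▸ hstat⟩, herg⟩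

end Main

end

end ShearFlow

theorem theorem1p1 (f₁ f₂ : C(ShearFlow.S1, ℝ))
    (hf₁ : ShearFlow.IsAnalytic f₁) (hf₂ : ShearFlow.IsAnalytic f₂)
    (hnc₁ : ¬ ∃ c : ℝ, ∀ z, f₁ z = c) (hnc₂ : ¬ ∃ c : ℝ, ∀ z, f₂ z = c)
    (H1₁ : ShearFlow.zeroSet f₁ ∩ ShearFlow.zeroSet (ShearFlow.circleDeriv f₁) = ∅)
    (H1₂ : ShearFlow.zeroSet f₂ ∩ ShearFlow.zeroSet (ShearFlow.circleDeriv f₂) = ∅) :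
    ∃ β b : ℝ, 0 < β ∧ β < 1 / 2 ∧ 0 < b ∧
      (∀ x, 1 ≤ ShearFlow.lyapunov f₁ f₂ β b x) ∧
      Continuous (ShearFlow.lyapunov f₁ f₂ β b) ∧
      ∃ T₀ : ℝ, 0 < T₀ ∧ ∀ T : ℝ, T₀ ≤ T →
        (∀ μ : MeasureTheory.Measure (ShearFlow.Phase f₁ f₂),
          ShearFlow.IsStationary (ShearFlow.transition f₁ f₂ T) μ ↔
            μ = ShearFlow.lebesgue f₁ f₂) ∧
        ShearFlow.UniformlyGeometricallyErgodic (ShearFlow.transition f₁ f₂ T)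
          (ShearFlow.lyapunov f₁ f₂ β b) := by
  have hz : ∀ f : C(ShearFlow.S1, ℝ), (¬ ∃ c : ℝ, ∀ z, f z = c) → ∃ z, f z ≠ 0 := fun f hf => by
    by_contra! h
    exact hf ⟨0, h⟩
  obtain ⟨z₁, hz₁⟩ := hz f₁ hnc₁
  obtain ⟨z₂, hz₂⟩ := hz f₂ hnc₂
  -- Any exponent in `(0, 1/2)` would do, and `b = 1` gives `V ≥ 1` because the singular part is
  -- nonnegative.
  refine ⟨1 / 4, 1, by norm_num, by norm_num, one_pos, fun x => ?_,
    ShearFlow.continuous_lyapunov (by norm_num) 1,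
    ShearFlow.exists_forall_ergodic H1₁ H1₂ hz₁ hz₂ (by norm_num) (by norm_num)⟩
  rw [ShearFlow.lyapunov_eq]
  exact le_add_of_nonneg_left ENNReal.toReal_nonneg
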